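/- Let $\mathcal R$ be Riemann's auxiliary function, $$\mathcal R(s)=\int_{0\swarrow 1}\frac{x^{-s}e^{\pi i x^2}}{e^{\pi i x}-e^{-\pi i x}}\,dx ,$$ where the path is a straight line of slope $1$, run through from upper right to lower left, that crosses the real axis between $0$ and $1$, and $x^{-s}$ is the principal power. (a) For every real $\sigma<\tfrac12$ the integral below converges for each $\varepsilon>0$, and as $\varepsilon\to0^+$ $$\int_1^{\infty}|\mathcal R(\sigma+it)|^2\Bigl(\frac{t}{2\pi}\Bigr)^{\sigma}e^{-\varepsilon t}\,dt\sim\frac{(2\varepsilon)^{-3/2}}{1-2\sigma}.$$ (b) For every real $\sigma$, as $T\to+\infty$, $$\frac1T\int_0^T|\mathcal R(\sigma+it)|^2\,dt\sim\begin{cases}\dfrac{2}{(1-2\sigma)(3-2\sigma)}\Bigl(\dfrac{T}{2\pi}\Bigr)^{\frac12-\sigma}&\text{if }\sigma<\tfrac12,\\[2mm] \dfrac12\log\dfrac{T}{2\pi}&\text{if }\sigma=\tfrac12,\\[2mm] \zeta(2\sigma)&\text{if }\sigma>\tfrac12.\end{cases}$$ (c) For every real $\sigma$ and every $a\ge0$,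 with $a>0$ or $\sigma>-1$, as $T\to+\infty$, $$\frac1T\int_a^T|\mathcal R(\sigma+it)|^2\Bigl(\frac{t}{2\pi}\Bigr)^{\sigma}dt\sim\begin{cases}\dfrac{2}{3(1-2\sigma)}\Bigl(\dfrac{T}{2\pi}\Bigr)^{\frac12}&\text{if }\sigma<\tfrac12,\\[2mm] \dfrac13\Bigl(\dfrac{T}{2\pi}\Bigr)^{\frac12}\log\dfrac{T}{2\pi}&\text{if }\sigma=\tfrac12,\\[2mm] \dfrac{\zeta(2\sigma)}{1+\sigma}\Bigl(\dfrac{T}{2\pi}\Bigr)^{\sigma}&\text{if }\sigma>\tfrac12.\end{cases}$$ All the integrals over bounded intervals in (b) and (c) exist. -/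

import Mathlib

open Filter Topology MeasureTheory Asymptotics Set

noncomputable section

/-- The straight line of slope one through `1/2`, run through from upper right to lower left:
the path written `0 ↙ 1`. It meets the real axis only at `1/2`, so it avoids every integer and
the cut `(-∞, 0]` of the principal branch of the logarithm. -/
def siegelLine (u : ℝ) : ℂ :=
  1 / 2 - (u : ℂ) * Complex.exp ((Real.pi : ℂ) * Complex.I / 4)

/-- The integrand `x^{-s} e^{π i x²} / (e^{π i x} - e^{-π i x})`, with the principal power. -/
def siegelIntegrand (s x : ℂ) : ℂ :=
  x ^ (-s) * Complex.exp ((Real.pi : ℂ) * Complex.I * x ^ 2) /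
    (Complex.exp ((Real.pi : ℂ) * Complex.I * x) - Complex.exp (-((Real.pi : ℂ) * Complex.I * x)))

/-- Riemann's auxiliary function: the contour integral of `siegelIntegrand s` along `siegelLine`,
whose derivative is the constant `-e^{π i / 4}`. -/
def riemannAux (s : ℂ) : ℂ :=
  ∫ u : ℝ, siegelIntegrand s (siegelLine u) * (-Complex.exp ((Real.pi : ℂ) * Complex.I / 4))

/-- `|R(σ + it)|²`. -/
def auxSq (σ t : ℝ) : ℝ :=
  ‖riemannAux ((σ : ℂ) + (t : ℂ) * Complex.I)‖ ^ 2

end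

/-! The proof approximates R by a Dirichlet polynomial of length N = ⌊√(t/2π)⌋. Moving the line of
integration to the right across the poles 1, …, N picks up n^{-s} at each of them
(`riemannAux_eq_sum_add`), and the integral left over runs along the line through N + 1/2. There t
arg x − 2π(d + y)y, the exponent that governs the size of the integrand, has its saddle near
√(t/2π), at bounded distance from the line. The integrand is therefore dominated by a constant times
t^{-σ/2} times a fixed Gaussian, and R(σ + it) = Σ_{n ≤ N} n^{-s} + O(t^{-σ/2})
(`exists_norm_sub_dirichletSum_sq_le`).

In the mean square of the polynomial, the diagonal contributes the integral of S(t) = Σ_{n ≤ N}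
n^{-2σ}. Each off-diagonal pair contributes at most 2(mn)^{-σ}/|log m − log n|, in all O(N log N ·
S(T)), which is o(T S(T)) because N² ≤ T. What remains is elementary: S(t) is asymptotic to
(t/2π)^{1/2−σ}/(1−2σ), to ½ log t, or to ζ(2σ). `IsMeanDensity` collects the properties of such a
density g that the argument uses, so that the three ranges of σ are treated together: for each of
them ∫(|R|² − g) = o(T g(T)) (`IsMeanDensity.isLittleO_auxSq`).

Partial summation inserts a weight t^ρ; ρ = 0 gives (b) and ρ = σ gives (c). Part (a) follows from
(c) by an Abelian theorem for the Laplace transform (`laplace_isEquivalent`) with exponent 3/2. -/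

/-! ### Contour integrals along lines of slope one -/

/-- The integral of `g` along the line of slope one through `c`, from upper right to lower left. -/
noncomputable def diagInt (g : ℂ → ℂ) (c : ℝ) : ℂ :=
  -((1 + Complex.I) * ∫ y : ℝ, g (c + (1 + Complex.I) * y))

lemma diag_re_sub_im (c y : ℝ) :
    ((c : ℂ) + (1 + Complex.I) * y).re - ((c : ℂ) + (1 + Complex.I) * y).im = c := by
  simp

lemma integrable_of_gaussian_bound {f : ℝ → ℂ} (hf : Continuous f) {C : ℝ}
    (hC : ∀ y, 1 ≤ |y| → ‖f y‖ ≤ C * Real.exp (-y ^ 2)) : Integrable f := by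
  obtain ⟨M, hM⟩ := (isCompact_Icc (a := (-1 : ℝ)) (b := 1)).exists_bound_of_continuousOn
    hf.continuousOn
  have hg : Integrable fun y : ℝ => (|C| + |M| * Real.exp 1) * Real.exp (-1 * y ^ 2) :=
    (integrable_exp_neg_mul_sq one_pos).const_mul _
  refine hg.mono' hf.aestronglyMeasurable (ae_of_all _ fun y => ?_)
  have hexp : 0 < Real.exp (-y ^ 2) := Real.exp_pos _
  rw [show -1 * y ^ 2 = -y ^ 2 by ring]
  rcases le_total 1 |y| with h | h
  · refine (hC y h).trans (mul_le_mul_of_nonneg_right ?_ hexp.le)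
    have : 0 ≤ |M| * Real.exp 1 := by positivity
    linarith [le_abs_self C]
  · refine (hM y (abs_le.1 h)).trans ?_
    have h1 : (1 : ℝ) ≤ Real.exp 1 * Real.exp (-y ^ 2) := by
      rw [← Real.exp_add]
      refine Real.one_le_exp ?_
      nlinarith [sq_abs y, abs_nonneg y]
    have h2 : 0 ≤ |C| * Real.exp (-y ^ 2) := by positivity
    nlinarith [le_abs_self M, abs_nonneg M]

/-- Meant for the two short sides of the rectangle in `diagInt_shift`. The point with coordinates x,
y of that rectangle has parameter x + y on its slope-one line, hence the Gaussian in x + y. -/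
lemma tendsto_integral_vertical_zero {F : ℝ → ℝ → ℂ} {C : ℝ}
    (hF : ∀ x y, 0 ≤ y → y ≤ 1 / 2 → 2 ≤ |x| → ‖F x y‖ ≤ C * Real.exp (-(x + y) ^ 2))
    {l : Filter ℝ} (hl : Tendsto (fun x : ℝ => |x|) l atTop) :
    Tendsto (fun x => ∫ y in (0 : ℝ)..(1 / 2), F x y) l (𝓝 0) := by
  have key : ∀ᶠ x in l, ‖∫ y in (0 : ℝ)..(1 / 2), F x y‖ ≤ |C| * Real.exp (-|x|) * |1 / 2 - 0| := by
    filter_upwards [hl.eventually_ge_atTop 3] with x hx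
    refine intervalIntegral.norm_integral_le_of_norm_le_const fun y hy => ?_
    rw [uIoc_of_le (by norm_num)] at hy
    refine (hF x y hy.1.le hy.2 (by linarith)).trans ?_
    refine mul_le_mul (le_abs_self C) (Real.exp_le_exp.2 ?_) (Real.exp_pos _).le (abs_nonneg _)
    have h0 := hy.1
    have h1 := hy.2
    rcases abs_cases x with ⟨h, -⟩ | ⟨h, -⟩ <;> rw [h] at hx ⊢ <;> nlinarith
  refine squeeze_zero_norm' key ?_
  have : Tendsto (fun x => Real.exp (-|x|)) l (𝓝 0) :=
    Real.tendsto_exp_neg_atTop_nhds_zero.comp hl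
  simpa using (this.const_mul |C|).mul_const |1 / 2 - (0 : ℝ)|

/-- Cauchy's theorem for two parallel lines of slope one. -/
lemma diagInt_shift {g : ℂ → ℂ} {c C : ℝ}
    (hg : ∀ z : ℂ, c ≤ z.re - z.im → z.re - z.im ≤ c + 1 → DifferentiableAt ℂ g z)
    (hC : ∀ d y : ℝ, c ≤ d → d ≤ c + 1 → 1 ≤ |y| →
      ‖g (d + (1 + Complex.I) * y)‖ ≤ C * Real.exp (-y ^ 2)) :
    diagInt g c = diagInt g (c + 1) := by
  have hcont : ∀ d : ℝ, c ≤ d → d ≤ c + 1 →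
      Continuous fun y : ℝ => g (d + (1 + Complex.I) * y) := fun d h1 h2 => by
    rw [continuous_iff_continuousAt]
    intro y
    have : ContinuousAt g (d + (1 + Complex.I) * y) :=
      (hg _ (by rw [diag_re_sub_im]; exact h1) (by rw [diag_re_sub_im]; exact h2)).continuousAt
    exact ContinuousAt.comp (f := fun y : ℝ => (d : ℂ) + (1 + Complex.I) * y) this (by fun_prop)
  have hint : ∀ d : ℝ, c ≤ d → d ≤ c + 1 →
      Integrable fun y : ℝ => g (d + (1 + Complex.I) * y) := fun d h1 h2 =>
    integrable_of_gaussian_bound (hcont d h1 h2) fun y hy => hC d y h1 h2 hy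
  -- Multiplication by 1 + i turns the slanted strip into a horizontal one. Height y corresponds to
  -- the line through c + 1 − 2y, so the rectangle has height 1/2.
  set F : ℂ → ℂ := fun z => g ((c + 1 : ℝ) + (1 + Complex.I) * z) with hFdef
  have harg : ∀ x y : ℝ, ((c + 1 : ℝ) : ℂ) + (1 + Complex.I) * (x + y * Complex.I) =
      ((c + 1 - 2 * y : ℝ) : ℂ) + (1 + Complex.I) * ((x + y : ℝ) : ℂ) := fun x y => by
    apply Complex.ext <;> simp <;> ring
  have hFxy : ∀ x y : ℝ, F (x + y * Complex.I) =
      g ((c + 1 - 2 * y : ℝ) + (1 + Complex.I) * ((x + y : ℝ) : ℂ)) := fun x y => by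
    rw [hFdef]; simp only []; rw [harg]
  have hbd : ∀ x y : ℝ, 0 ≤ y → y ≤ 1 / 2 → 2 ≤ |x| →
      ‖F (x + y * Complex.I)‖ ≤ C * Real.exp (-(x + y) ^ 2) := fun x y h0 h1 h2 => by
    rw [hFxy]
    refine hC _ _ (by linarith) (by linarith) ?_
    rcases le_total 0 x with h | h
    · rw [abs_of_nonneg h] at h2; rw [abs_of_nonneg] <;> linarith
    · rw [abs_of_nonpos h] at h2; rw [abs_of_nonpos] <;> linarith
  have hF0 : Integrable fun x : ℝ => F (x + (0 : ℝ) * Complex.I) := by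
    simp_rw [hFxy]
    simpa using hint (c + 1) (by linarith) le_rfl
  have e1 : (fun x : ℝ => F (x + (1 / 2 : ℝ) * Complex.I)) =
      fun x : ℝ => (fun y : ℝ => g (c + (1 + Complex.I) * y)) (x + 1 / 2) := by
    funext x
    rw [hFxy]
    norm_num
  have hF1 : Integrable fun x : ℝ => F (x + (1 / 2 : ℝ) * Complex.I) := by
    rw [e1]
    exact (hint c le_rfl (by linarith)).comp_add_right (1 / 2)
  have hrect : ∀ R : ℝ, (∫ x : ℝ in -R..R, F (x + (0 : ℝ) * Complex.I)) -
      (∫ x : ℝ in -R..R, F (x + (1 / 2 : ℝ) * Complex.I)) =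
      Complex.I • (∫ y : ℝ in (0 : ℝ)..(1 / 2), F ((-R : ℝ) + y * Complex.I)) -
      Complex.I • (∫ y : ℝ in (0 : ℝ)..(1 / 2), F (R + y * Complex.I)) := fun R => by
    have := Complex.integral_boundary_rect_eq_zero_of_differentiableOn F
      ⟨-R, 0⟩ ⟨R, 1 / 2⟩ (by
        intro z hz
        rw [Complex.mem_reProdIm] at hz
        have hz2 := hz.2
        simp only [] at hz2
        rw [uIcc_of_le (by norm_num), mem_Icc] at hz2
        have hd : DifferentiableAt ℂ g ((c + 1 : ℝ) + (1 + Complex.I) * z) := by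
          apply hg <;> simp <;> linarith
        have : DifferentiableAt ℂ F z :=
          DifferentiableAt.comp (f := fun z : ℂ => ((c + 1 : ℝ) : ℂ) + (1 + Complex.I) * z)
            z hd (by fun_prop)
        exact this.differentiableWithinAt)
    simp only [] at this
    linear_combination this
  have ht1 : Tendsto (fun R : ℝ => |(-R)|) atTop atTop := by
    simpa using tendsto_abs_atTop_atTop
  have hR0 := (tendsto_integral_vertical_zero hbd (l := atBot) tendsto_abs_atBot_atTop).comp
    tendsto_neg_atTop_atBot
  have hR1 := tendsto_integral_vertical_zero hbd (l := atTop) tendsto_abs_atTop_atTop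
  have hlim := (hR0.const_smul Complex.I).sub (hR1.const_smul Complex.I)
  have hL := (intervalIntegral_tendsto_integral hF0 tendsto_neg_atTop_atBot tendsto_id).sub
    (intervalIntegral_tendsto_integral hF1 tendsto_neg_atTop_atBot tendsto_id)
  have heq := tendsto_nhds_unique (hL.congr fun R => hrect R) hlim
  simp only [smul_zero, sub_zero] at heq
  rw [sub_eq_zero, e1, integral_add_right_eq_self (fun y : ℝ => g (c + (1 + Complex.I) * y))] at heq
  unfold diagInt
  rw [← heq]
  simp [hFdef]

/-! ### Size of the integrand on the lines of slope one -/

lemma exp_quarter : Complex.exp ((Real.pi : ℂ) * Complex.I / 4) =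
    (1 + Complex.I) / (Real.sqrt 2 : ℝ) := by
  have : (Real.pi : ℂ) * Complex.I / 4 = ((Real.pi / 4 : ℝ) : ℂ) * Complex.I := by push_cast; ring
  rw [this, Complex.exp_mul_I, ← Complex.ofReal_cos, ← Complex.ofReal_sin, Real.cos_pi_div_four,
    Real.sin_pi_div_four]
  have h2 : ((Real.sqrt 2 : ℝ) : ℂ) ^ 2 = 2 := by
    rw [← Complex.ofReal_pow, Real.sq_sqrt (by norm_num)]; norm_num
  have h0 : ((Real.sqrt 2 : ℝ) : ℂ) ≠ 0 := by
    intro h; rw [h] at h2; norm_num at h2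
  field_simp
  push_cast
  linear_combination (1 + Complex.I) / 2 * h2

/-- Since e^{πi/4} = (1 + i)/√2, the substitution y = −u/√2 matches the two parametrizations of the
line. -/
lemma riemannAux_eq_diagInt (s : ℂ) :
    riemannAux s = diagInt (siegelIntegrand s) (1 / 2) := by
  have h2 : (Real.sqrt 2 : ℝ) ≠ 0 := by positivity
  unfold riemannAux diagInt
  rw [integral_mul_const, exp_quarter]
  have key := Measure.integral_comp_mul_left (fun y : ℝ => siegelIntegrand s
    ((1 / 2 : ℝ) + (1 + Complex.I) * y)) (-(Real.sqrt 2)⁻¹)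
  have e : ∀ u : ℝ, siegelIntegrand s (siegelLine u) = siegelIntegrand s
      ((1 / 2 : ℝ) + (1 + Complex.I) * ((-(Real.sqrt 2)⁻¹ * u : ℝ) : ℂ)) := fun u => by
    congr 1
    unfold siegelLine
    rw [exp_quarter]
    push_cast
    ring
  simp_rw [e]
  rw [key, inv_neg, inv_inv, abs_neg, abs_of_pos (by positivity), Complex.real_smul]
  have h3 : ((Real.sqrt 2 : ℝ) : ℂ) ≠ 0 := by exact_mod_cast h2
  field_simp

/-- The denominator of `siegelIntegrand`. -/
noncomputable def siegelDenom (x : ℂ) : ℂ :=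
  Complex.exp ((Real.pi : ℂ) * Complex.I * x) - Complex.exp (-((Real.pi : ℂ) * Complex.I * x))

lemma siegelIntegrand_eq (s x : ℂ) : siegelIntegrand s x =
    x ^ (-s) * Complex.exp ((Real.pi : ℂ) * Complex.I * x ^ 2) / siegelDenom x := rfl

lemma siegelDenom_eq_sin (x : ℂ) : siegelDenom x = 2 * Complex.I * Complex.sin (Real.pi * x) := by
  have h : Complex.sin (Real.pi * x) = (Complex.exp (-((Real.pi : ℂ) * Complex.I * x)) -
      Complex.exp ((Real.pi : ℂ) * Complex.I * x)) * Complex.I / 2 := by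
    rw [Complex.sin]
    congr 3 <;> [congr 1; congr 1] <;> ring
  rw [h, siegelDenom]
  linear_combination -(Complex.exp (-((Real.pi : ℂ) * Complex.I * x)) -
      Complex.exp ((Real.pi : ℂ) * Complex.I * x)) * Complex.I_sq

lemma norm_siegelDenom_sq (x : ℂ) : ‖siegelDenom x‖ ^ 2 =
    4 * (Real.sinh (Real.pi * x.im) ^ 2 + Real.sin (Real.pi * x.re) ^ 2) := by
  have h : (Real.pi : ℂ) * x =
      ((Real.pi * x.re : ℝ) : ℂ) + ((Real.pi * x.im : ℝ) : ℂ) * Complex.I := by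
    apply Complex.ext <;> simp
  rw [siegelDenom_eq_sin, h, Complex.sin_add_mul_I, ← Complex.ofReal_sin, ← Complex.ofReal_cos,
    ← Complex.ofReal_cosh, ← Complex.ofReal_sinh, ← Complex.ofReal_mul, ← Complex.ofReal_mul,
    norm_mul, mul_pow, Complex.sq_norm (_ + _), Complex.normSq_add_mul_I]
  simp only [Complex.norm_mul, Complex.norm_ofNat, Complex.norm_I, mul_one]
  rw [mul_pow, mul_pow, Real.cosh_sq, Real.cos_sq']
  ring

lemma sq_le_sinh_sq (b : ℝ) : b ^ 2 ≤ Real.sinh b ^ 2 := by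
  rw [← sq_abs b, ← sq_abs (Real.sinh b), Real.abs_sinh]
  exact pow_le_pow_left₀ (abs_nonneg b) (Real.self_le_sinh_iff.2 (abs_nonneg b)) 2

/-- The squared norm is 4(sinh²(πy) + sin²(π(d + y))). For |y| ≥ 1 the first term suffices. On a
line through a half-integer the second term is 1 − sin²(πy), and sinh²(πy) ≥ (πy)² ≥ sin²(πy)
compensates the loss. -/
lemma one_le_norm_siegelDenom {d y : ℝ} (h : 1 ≤ |y| ∨ Real.cos (Real.pi * d) = 0) :
    1 ≤ ‖siegelDenom (d + (1 + Complex.I) * y)‖ := by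
  have key : 1 ≤ ‖siegelDenom (d + (1 + Complex.I) * y)‖ ^ 2 := by
    rw [norm_siegelDenom_sq]
    have him : ((d : ℂ) + (1 + Complex.I) * y).im = y := by simp
    have hre : ((d : ℂ) + (1 + Complex.I) * y).re = d + y := by simp
    rw [him, hre]
    have h1 := sq_le_sinh_sq (Real.pi * y)
    rcases h with h | h
    · have : 1 ≤ y ^ 2 := by rw [← sq_abs]; nlinarith
      have h2 : 1 ≤ Real.pi ^ 2 := by nlinarith [Real.pi_gt_three]
      nlinarith [sq_nonneg (Real.sin (Real.pi * (d + y)))]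
    · have h3 := Real.sin_sq_add_cos_sq (Real.pi * d)
      rw [mul_add Real.pi d y, Real.sin_add, h, zero_mul, add_zero, mul_pow,
        show Real.sin (Real.pi * d) ^ 2 = 1 by rw [← h3, h]; ring, one_mul, Real.cos_sq']
      have h4 : Real.sin (Real.pi * y) ^ 2 ≤ (Real.pi * y) ^ 2 := sq_le_sq.2 Real.abs_sin_le_abs
      linarith
  nlinarith [norm_nonneg (siegelDenom (d + (1 + Complex.I) * y))]

lemma siegelDenom_eq_zero {x : ℂ} (h : siegelDenom x = 0) : ∃ n : ℤ, x = n := by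
  have h0 := norm_siegelDenom_sq x
  rw [h, norm_zero] at h0
  have h1 : Real.sinh (Real.pi * x.im) = 0 := by
    nlinarith [sq_nonneg (Real.sinh (Real.pi * x.im)), sq_nonneg (Real.sin (Real.pi * x.re))]
  have h2 : Real.sin (Real.pi * x.re) = 0 := by
    nlinarith [sq_nonneg (Real.sinh (Real.pi * x.im)), sq_nonneg (Real.sin (Real.pi * x.re))]
  rw [Real.sinh_eq_zero] at h1
  obtain ⟨n, hn⟩ := Real.sin_eq_zero_iff.1 h2
  have hpi := Real.pi_ne_zero
  refine ⟨n, Complex.ext ?_ ?_⟩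
  · have : x.re = n := by
      apply mul_left_cancel₀ hpi; rw [← hn]; ring
    simpa using this
  · simpa [hpi] using h1

lemma diag_normSq (d y : ℝ) :
    ‖(d : ℂ) + (1 + Complex.I) * y‖ ^ 2 = (d + y) ^ 2 + y ^ 2 := by
  rw [Complex.sq_norm, Complex.normSq_apply]
  simp
  ring

/-- Both signs of σ are covered by d/2 ≤ |x| ≤ d e^{4|y|}; the upper bound uses d ≥ 1/2. -/
lemma diag_norm_rpow_le {d : ℝ} (hd : 1 / 2 ≤ d) (σ y : ℝ) :
    ‖(d : ℂ) + (1 + Complex.I) * y‖ ^ (-σ) ≤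
      2 ^ |σ| * Real.exp (4 * |σ| * |y|) * d ^ (-σ) := by
  set r := ‖(d : ℂ) + (1 + Complex.I) * y‖ with hr
  have hsq := diag_normSq d y
  rw [← hr] at hsq
  have hd0 : 0 < d := by linarith
  have hr0 : 0 ≤ r := norm_nonneg _
  have hlow : d * (1 / 2) ≤ r := by
    refine le_of_sq_le_sq ?_ hr0
    rw [hsq]
    nlinarith [sq_nonneg (d + 2 * y)]
  have hup : r ≤ d * Real.exp (4 * |y|) := by
    have h1 : r ≤ d + 2 * |y| := by
      refine le_of_sq_le_sq ?_ (by positivity)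
      rw [hsq]
      have := sq_abs y
      nlinarith [le_abs_self y, abs_nonneg y]
    have h2 := Real.add_one_le_exp (4 * |y|)
    nlinarith [abs_nonneg y]
  have hrpos : 0 < r := by linarith
  have h2 : (1 : ℝ) ≤ 2 ^ |σ| := Real.one_le_rpow (by norm_num) (abs_nonneg _)
  have h3 : 1 ≤ Real.exp (4 * |σ| * |y|) := Real.one_le_exp (by positivity)
  have hdp : 0 < d ^ (-σ) := Real.rpow_pos_of_pos hd0 _
  rcases le_total 0 σ with h | h
  · have : r ^ (-σ) ≤ (d * (1 / 2)) ^ (-σ) :=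
      Real.rpow_le_rpow_of_nonpos (by positivity) hlow (by linarith)
    rw [Real.mul_rpow hd0.le (by norm_num), one_div, Real.inv_rpow (by norm_num),
      Real.rpow_neg (zero_le_two (α := ℝ)), inv_inv] at this
    rw [abs_of_nonneg h] at *
    calc r ^ (-σ) ≤ d ^ (-σ) * 2 ^ σ := this
      _ = 2 ^ σ * 1 * d ^ (-σ) := by ring
      _ ≤ _ := by gcongr
  · have : r ^ (-σ) ≤ (d * Real.exp (4 * |y|)) ^ (-σ) :=
      Real.rpow_le_rpow hr0 hup (by linarith)
    rw [Real.mul_rpow hd0.le (Real.exp_pos _).le, ← Real.exp_mul] at this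
    rw [abs_of_nonpos h] at *
    calc r ^ (-σ) ≤ d ^ (-σ) * Real.exp (4 * |y| * -σ) := this
      _ = 1 * Real.exp (4 * -σ * |y|) * d ^ (-σ) := by
        rw [show 4 * |y| * -σ = 4 * -σ * |y| by ring]; ring
      _ ≤ _ := by gcongr

lemma norm_siegelIntegrand_le {d : ℝ} (hd : 1 / 2 ≤ d) {y : ℝ}
    (h : 1 ≤ |y| ∨ Real.cos (Real.pi * d) = 0) (σ t : ℝ) :
    ‖siegelIntegrand (σ + t * Complex.I) (d + (1 + Complex.I) * y)‖ ≤
      2 ^ |σ| * d ^ (-σ) * Real.exp (4 * |σ| * |y| +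
        t * Complex.arg (d + (1 + Complex.I) * y) - 2 * Real.pi * (d + y) * y) := by
  have hx : (d : ℂ) + (1 + Complex.I) * y ≠ 0 := by
    intro h0
    have := diag_re_sub_im d y
    rw [h0] at this
    simp at this
    linarith
  have hre : ((Real.pi : ℂ) * Complex.I * ((d : ℂ) + (1 + Complex.I) * y) ^ 2).re =
      -(2 * Real.pi * (d + y) * y) := by
    simp [sq]
    ring
  rw [siegelIntegrand_eq, norm_div, norm_mul, Complex.norm_cpow_of_ne_zero hx, Complex.norm_exp,
    hre]
  refine (div_le_self (by positivity) (one_le_norm_siegelDenom h)).trans ?_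
  have e1 : (-((σ : ℂ) + t * Complex.I)).re = -σ := by simp
  have e2 : (-((σ : ℂ) + t * Complex.I)).im = -t := by simp
  rw [e1, e2, div_eq_mul_inv, ← Real.exp_neg]
  have := diag_norm_rpow_le hd σ y
  calc _ ≤ (2 ^ |σ| * Real.exp (4 * |σ| * |y|) * d ^ (-σ)) *
        Real.exp (-(Complex.arg (d + (1 + Complex.I) * y) * -t)) *
        Real.exp (-(2 * Real.pi * (d + y) * y)) := by gcongr
    _ = 2 ^ |σ| * d ^ (-σ) * (Real.exp (4 * |σ| * |y|) *
        Real.exp (-(Complex.arg (d + (1 + Complex.I) * y) * -t)) *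
        Real.exp (-(2 * Real.pi * (d + y) * y))) := by ring
    _ = _ := by
      rw [← Real.exp_add, ← Real.exp_add]
      congr 2
      ring

/-- A crude bound, uniform for t in a bounded set and for lines in a strip of width one. It serves
integrability, the shift of the contour and continuity in t, not the asymptotics. -/
lemma exists_siegelIntegrand_gaussian_bound (σ M c : ℝ) (hc : 1 / 2 ≤ c) :
    ∃ C : ℝ, ∀ t d y : ℝ, |t| ≤ M → c ≤ d → d ≤ c + 1 →
      (1 ≤ |y| ∨ Real.cos (Real.pi * d) = 0) →
      ‖siegelIntegrand (σ + t * Complex.I) (d + (1 + Complex.I) * y)‖ ≤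
        C * Real.exp (-y ^ 2) := by
  obtain ⟨B, hB⟩ := (isCompact_Icc (a := c) (b := c + 1)).exists_bound_of_continuousOn
    (f := fun d : ℝ => d ^ (-σ)) (fun d hd => (Real.continuousAt_rpow_const _ _
      (Or.inl (by linarith [hd.1]))).continuousWithinAt)
  set K := 4 * |σ| + 2 * Real.pi * (c + 1) with hK
  refine ⟨2 ^ |σ| * B * Real.exp (M * Real.pi + K ^ 2 / 4), fun t d y ht h1 h2 h => ?_⟩
  have hd : 1 / 2 ≤ d := hc.trans h1
  refine (norm_siegelIntegrand_le hd h σ t).trans ?_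
  have hB' := hB d ⟨h1, h2⟩
  rw [Real.norm_of_nonneg (Real.rpow_nonneg (by linarith) _)] at hB'
  rw [mul_assoc _ (Real.exp _) (Real.exp _), ← Real.exp_add]
  have harg : t * Complex.arg (d + (1 + Complex.I) * y) ≤ M * Real.pi := by
    refine (le_abs_self _).trans ?_
    rw [abs_mul]
    exact mul_le_mul ht (Complex.abs_arg_le_pi _) (abs_nonneg _) ((abs_nonneg _).trans ht)
  have hdy : -(2 * Real.pi * d * y) ≤ 2 * Real.pi * (c + 1) * |y| := by
    have h3 : -(d * y) ≤ (c + 1) * |y| := by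
      nlinarith [neg_abs_le y, abs_nonneg y]
    nlinarith [Real.pi_pos]
  have hq : K * |y| - 2 * Real.pi * y ^ 2 ≤ K ^ 2 / 4 - y ^ 2 := by
    nlinarith [sq_nonneg (|y| - K / 2), sq_abs y, Real.pi_gt_three, sq_nonneg y]
  refine mul_le_mul (mul_le_mul_of_nonneg_left hB' (by positivity)) (Real.exp_le_exp.2 ?_)
    (Real.exp_pos _).le ?_
  · have : K * |y| = 4 * |σ| * |y| + 2 * Real.pi * (c + 1) * |y| := by rw [hK]; ring
    nlinarith
  · exact mul_nonneg (by positivity) ((Real.rpow_nonneg (by linarith) _).trans hB')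

/-! ### Crossing an integer: the Dirichlet terms -/

lemma mem_slitPlane_of_diag {z : ℂ} (h : 0 < z.re - z.im) : z ∈ Complex.slitPlane := by
  rw [Complex.mem_slitPlane_iff]
  by_cases h0 : z.im = 0
  · left; linarith
  · exact Or.inr h0

lemma differentiable_siegelDenom : Differentiable ℂ siegelDenom := by
  unfold siegelDenom
  fun_prop

lemma siegelDenom_natCast (n : ℕ) : siegelDenom n = 0 := by
  rw [siegelDenom_eq_sin, mul_comm (Real.pi : ℂ), Complex.sin_nat_mul_pi, mul_zero]

lemma deriv_siegelDenom_natCast_ne_zero (n : ℕ) : deriv siegelDenom n ≠ 0 := by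
  have h : HasDerivAt siegelDenom (2 * Complex.I * (Complex.cos (Real.pi * n) * Real.pi)) n := by
    have h1 : HasDerivAt (fun x : ℂ => (Real.pi : ℂ) * x) (Real.pi : ℂ) (n : ℂ) := by
      simpa using (hasDerivAt_id (n : ℂ)).const_mul (Real.pi : ℂ)
    have := (h1.csin).const_mul (2 * Complex.I)
    exact this.congr_of_eventuallyEq (Eventually.of_forall siegelDenom_eq_sin)
  rw [h.deriv]
  have hc : Complex.cos (Real.pi * n) ≠ 0 := by
    intro h0
    have h1 := Complex.sin_sq_add_cos_sq (Real.pi * n)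
    rw [h0, mul_comm, Complex.sin_nat_mul_pi] at h1
    norm_num at h1
  have := Real.pi_ne_zero
  simp [hc, this]

lemma siegelDenom_ne_zero_of_strip {n : ℕ} {z : ℂ} (h1 : (n : ℝ) - 1 / 2 ≤ z.re - z.im)
    (h2 : z.re - z.im ≤ (n : ℝ) + 1 / 2) (hz : z ≠ n) : siegelDenom z ≠ 0 := by
  intro h0
  obtain ⟨m, rfl⟩ := siegelDenom_eq_zero h0
  simp at h1 h2
  have h3 : (n : ℤ) - 1 < m := by
    have : ((n : ℤ) : ℝ) - 1 < m := by push_cast; linarith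
    exact_mod_cast this
  have h4 : m < n + 1 := by
    have : (m : ℝ) < (n : ℤ) + 1 := by push_cast; linarith
    exact_mod_cast this
  have : m = n := by omega
  exact hz (by rw [this]; simp)

lemma differentiableAt_cpow_neg {z s : ℂ} (hz : z ∈ Complex.slitPlane) :
    DifferentiableAt ℂ (fun x : ℂ => x ^ (-s)) z :=
  DifferentiableAt.cpow differentiableAt_id (differentiableAt_const _) hz

/-- `siegelIntegrand s x - n⁻ˢ siegelIntegrand 0 x` with the singularity at `n` removed. -/
noncomputable def siegelRegular (s : ℂ) (n : ℕ) (x : ℂ) : ℂ :=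
  dslope (fun x : ℂ => x ^ (-s)) n x * Complex.exp ((Real.pi : ℂ) * Complex.I * x ^ 2) /
    dslope siegelDenom n x

lemma siegelRegular_of_ne {s x : ℂ} {n : ℕ} (hx : x ≠ n) :
    siegelRegular s n x = siegelIntegrand s x - (n : ℂ) ^ (-s) * siegelIntegrand 0 x := by
  unfold siegelRegular
  rw [dslope_of_ne _ hx, dslope_of_ne _ hx, slope_def_field, slope_def_field,
    siegelDenom_natCast, sub_zero, siegelIntegrand_eq, siegelIntegrand_eq, neg_zero,
    Complex.cpow_zero]
  have : x - n ≠ 0 := sub_ne_zero.2 hx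
  -- At the other zeros of the denominator both sides are 0, because division by zero gives 0.
  by_cases h : siegelDenom x = 0
  · simp [h]
  · field_simp

/-- Both divided differences are holomorphic. The one in the denominator does not vanish in this
strip: n is the only integer there, and it is a simple zero. -/
lemma differentiableAt_siegelRegular {s z : ℂ} {n : ℕ} (hn : 1 ≤ n)
    (h1 : (n : ℝ) - 1 / 2 ≤ z.re - z.im) (h2 : z.re - z.im ≤ (n : ℝ) + 1 / 2) :
    DifferentiableAt ℂ (siegelRegular s n) z := by
  have hn1 : (1 : ℝ) ≤ n := by exact_mod_cast hn
  have hzs : z ∈ Complex.slitPlane := mem_slitPlane_of_diag (by linarith)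
  have hns : (n : ℂ) ∈ Complex.slitPlane := mem_slitPlane_of_diag (by simp; linarith)
  have hP : DifferentiableAt ℂ (dslope (fun x : ℂ => x ^ (-s)) n) z := by
    have : DifferentiableOn ℂ (fun x : ℂ => x ^ (-s)) Complex.slitPlane :=
      fun x hx => (differentiableAt_cpow_neg hx).differentiableWithinAt
    exact ((Complex.differentiableOn_dslope (Complex.isOpen_slitPlane.mem_nhds hns)).2
      this).differentiableAt (Complex.isOpen_slitPlane.mem_nhds hzs)
  have hD : DifferentiableAt ℂ (dslope siegelDenom n) z :=
    ((Complex.differentiableOn_dslope (c := (n : ℂ)) univ_mem).2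
      differentiable_siegelDenom.differentiableOn).differentiableAt univ_mem
  have hD0 : dslope siegelDenom n z ≠ 0 := by
    by_cases hz : z = n
    · rw [hz, dslope_same]
      exact deriv_siegelDenom_natCast_ne_zero n
    · rw [dslope_of_ne _ hz, slope_def_field, siegelDenom_natCast, sub_zero]
      exact div_ne_zero (siegelDenom_ne_zero_of_strip h1 h2 hz) (sub_ne_zero.2 hz)
  exact (hP.mul (by fun_prop)).div hD hD0

lemma continuous_siegelIntegrand_diag {d : ℝ} (hd : 1 / 2 ≤ d)
    (h : Real.cos (Real.pi * d) = 0) (s : ℂ) :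
    Continuous fun y : ℝ => siegelIntegrand s (d + (1 + Complex.I) * y) := by
  have h1 : Continuous fun y : ℝ => ((d : ℂ) + (1 + Complex.I) * y) ^ (-s) :=
    Continuous.cpow (by fun_prop) continuous_const fun y =>
      mem_slitPlane_of_diag (by rw [diag_re_sub_im]; linarith)
  have h2 : Continuous fun y : ℝ => siegelDenom (d + (1 + Complex.I) * y) :=
    differentiable_siegelDenom.continuous.comp (by fun_prop)
  refine Continuous.div (h1.mul (by fun_prop)) h2 fun y h0 => ?_
  have := one_le_norm_siegelDenom (d := d) (y := y) (Or.inr h)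
  unfold siegelDenom at this h0
  rw [h0, norm_zero] at this
  linarith

lemma integrable_siegelIntegrand_diag {d : ℝ} (hd : 1 / 2 ≤ d)
    (h : Real.cos (Real.pi * d) = 0) (s : ℂ) :
    Integrable fun y : ℝ => siegelIntegrand s (d + (1 + Complex.I) * y) := by
  obtain ⟨C, hC⟩ := exists_siegelIntegrand_gaussian_bound s.re |s.im| d hd
  refine integrable_of_gaussian_bound (continuous_siegelIntegrand_diag hd h s) (C := C)
    fun y hy => ?_
  have := hC s.im d y le_rfl le_rfl (by linarith) (Or.inl hy)
  rwa [Complex.re_add_im] at this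

lemma diagInt_sub_const_mul {g h : ℂ → ℂ} {c : ℝ} (a : ℂ)
    (hg : Integrable fun y : ℝ => g (c + (1 + Complex.I) * y))
    (hh : Integrable fun y : ℝ => h (c + (1 + Complex.I) * y)) :
    diagInt (fun x => g x - a * h x) c = diagInt g c - a * diagInt h c := by
  unfold diagInt
  rw [integral_sub hg (hh.const_mul a), integral_const_mul]
  ring

lemma cos_pi_mul_add_half (n : ℕ) : Real.cos (Real.pi * (n + 1 / 2)) = 0 := by
  exact Real.cos_eq_zero_iff.2 ⟨n, by push_cast; ring⟩

/-- The case s = 0 needs no residue theorem: the integrand Φ satisfies Φ(x + 1) − Φ(x) = e^{πi(x² +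
x)}, so the difference of the two line integrals is an explicit Gaussian integral. -/
lemma diagInt_siegelIntegrand_zero_sub (n : ℕ) :
    diagInt (siegelIntegrand 0) (n + 1 / 2) - diagInt (siegelIntegrand 0) (n + 1 / 2 + 1) = 1 := by
  have hn : (0 : ℝ) ≤ n := n.cast_nonneg
  have i1 := integrable_siegelIntegrand_diag (d := n + 1 / 2) (by linarith)
    (cos_pi_mul_add_half n) 0
  have i2 := integrable_siegelIntegrand_diag (d := n + 1 / 2 + 1) (by linarith) (by
    have := cos_pi_mul_add_half (n + 1); push_cast at this; rwa [add_right_comm]) 0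
  unfold diagInt
  have e : ∀ y : ℝ, siegelIntegrand 0 ((n + 1 / 2 + 1 : ℝ) + (1 + Complex.I) * y) -
      siegelIntegrand 0 ((n + 1 / 2 : ℝ) + (1 + Complex.I) * y) =
      Complex.exp ((-(2 * Real.pi) : ℂ) * y ^ 2 +
        (2 * Real.pi * Complex.I * (n + 1) * (1 + Complex.I)) * y +
        (Real.pi * Complex.I * ((n + 1) ^ 2 - 1 / 4))) := fun y => by
    set x : ℂ := ((n + 1 / 2 : ℝ) : ℂ) + (1 + Complex.I) * y with hx
    have hx1 : ((n + 1 / 2 + 1 : ℝ) : ℂ) + (1 + Complex.I) * y = x + 1 := by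
      rw [hx]; push_cast; ring
    have hD : siegelDenom x ≠ 0 := fun h0 => by
      have := one_le_norm_siegelDenom (d := n + 1 / 2) (y := y)
        (Or.inr (cos_pi_mul_add_half n))
      rw [← hx, h0, norm_zero] at this
      linarith
    have hE1 : Complex.exp ((Real.pi : ℂ) * Complex.I * (x + 1)) =
        -Complex.exp ((Real.pi : ℂ) * Complex.I * x) := by
      rw [mul_add, mul_one, Complex.exp_add, Complex.exp_pi_mul_I]; ring
    have hE2 : Complex.exp (-((Real.pi : ℂ) * Complex.I * (x + 1))) =
        -Complex.exp (-((Real.pi : ℂ) * Complex.I * x)) := by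
      rw [Complex.exp_neg, hE1, Complex.exp_neg, inv_neg]
    have hD1 : siegelDenom (x + 1) = -siegelDenom x := by
      unfold siegelDenom; rw [hE1, hE2]; ring
    have hq : Complex.exp ((Real.pi : ℂ) * Complex.I * (x + 1) ^ 2) =
        -(Complex.exp ((Real.pi : ℂ) * Complex.I * x ^ 2) *
        (Complex.exp ((Real.pi : ℂ) * Complex.I * x) *
          Complex.exp ((Real.pi : ℂ) * Complex.I * x))) := by
      rw [← Complex.exp_add, ← Complex.exp_add, show (Real.pi : ℂ) * Complex.I * (x + 1) ^ 2 =
        (Real.pi : ℂ) * Complex.I * x ^ 2 + ((Real.pi : ℂ) * Complex.I * x +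
          (Real.pi : ℂ) * Complex.I * x) + (Real.pi : ℂ) * Complex.I by ring, Complex.exp_add _
          ((Real.pi : ℂ) * Complex.I), Complex.exp_pi_mul_I]
      ring
    have hm : Complex.exp ((Real.pi : ℂ) * Complex.I * x) *
        Complex.exp (-((Real.pi : ℂ) * Complex.I * x)) = 1 := by
      rw [← Complex.exp_add, add_neg_cancel, Complex.exp_zero]
    have hfin : Complex.exp ((-(2 * Real.pi) : ℂ) * y ^ 2 +
        (2 * Real.pi * Complex.I * (n + 1) * (1 + Complex.I)) * y +
        (Real.pi * Complex.I * ((n + 1) ^ 2 - 1 / 4))) =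
        Complex.exp ((Real.pi : ℂ) * Complex.I * x ^ 2) *
          Complex.exp ((Real.pi : ℂ) * Complex.I * x) := by
      -- The exponent is πi((x + 1/2)² − 1/4) with x + 1/2 = n + 1 + (1 + i)y, and (1 + i)² = 2i
      -- makes the quadratic part −2πy².
      rw [← Complex.exp_add]
      congr 1
      rw [hx]
      push_cast
      linear_combination (-Real.pi * (Complex.I + 2) * y ^ 2 : ℂ) * Complex.I_sq
    rw [hx1, hfin, siegelIntegrand_eq, siegelIntegrand_eq, hD1, hq, neg_zero, Complex.cpow_zero,
      Complex.cpow_zero]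
    field_simp
    unfold siegelDenom
    linear_combination hm
  have h2 : (∫ y : ℝ, siegelIntegrand 0 ((n + 1 / 2 + 1 : ℝ) + (1 + Complex.I) * y)) -
      (∫ y : ℝ, siegelIntegrand 0 ((n + 1 / 2 : ℝ) + (1 + Complex.I) * y)) =
      (1 + Complex.I)⁻¹ := by
    rw [← integral_sub i2 i1]
    simp_rw [e]
    have hre : (-(2 * Real.pi) : ℂ).re < 0 := by simp [Real.pi_pos]
    rw [integral_cexp_quadratic hre]
    have hpi : (Real.pi : ℂ) ≠ 0 := by exact_mod_cast Real.pi_ne_zero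
    have hb : (Real.pi : ℂ) / -(-(2 * Real.pi)) = ((1 / 2 : ℝ) : ℂ) := by
      push_cast
      field_simp
    have hs : ((1 / 2 : ℝ) : ℂ) ^ (1 / 2 : ℂ) = ((Real.sqrt 2 : ℝ) : ℂ)⁻¹ := by
      rw [show (1 / 2 : ℂ) = ((1 / 2 : ℝ) : ℂ) by push_cast; ring,
        ← Complex.ofReal_cpow (by norm_num), ← Real.sqrt_eq_rpow, ← Complex.ofReal_inv]
      congr 1
      rw [one_div, Real.sqrt_inv]
    have hexp : (Real.pi * Complex.I * ((n + 1) ^ 2 - 1 / 4)) -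
        (2 * Real.pi * Complex.I * (n + 1) * (1 + Complex.I)) ^ 2 / (4 * -(2 * Real.pi)) =
        -((Real.pi : ℂ) * Complex.I / 4) := by
      field_simp
      linear_combination (2 * (n + 1 : ℂ) ^ 2 * (Complex.I + 2)) * Complex.I_sq
    rw [hb, hs, hexp, Complex.exp_neg, exp_quarter]
    have h3 : ((Real.sqrt 2 : ℝ) : ℂ) ≠ 0 := by
      have : Real.sqrt 2 ≠ 0 := by positivity
      exact_mod_cast this
    field_simp
  have hI : (1 + Complex.I) ≠ 0 := fun h => by
    have := congrArg Complex.re h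
    simp at this
  calc _ = (1 + Complex.I) *
      ((∫ y : ℝ, siegelIntegrand 0 ((n + 1 / 2 + 1 : ℝ) + (1 + Complex.I) * y)) -
      (∫ y : ℝ, siegelIntegrand 0 ((n + 1 / 2 : ℝ) + (1 + Complex.I) * y))) := by ring
    _ = 1 := by rw [h2, mul_inv_cancel₀ hI]

/-- With k = n + 1, subtracting k^{-s} times the integrand for s = 0 removes the pole at k. Cauchy's
theorem applies to the difference, and the contribution of the pole is known from the case s = 0. -/
lemma diagInt_siegelIntegrand_sub (s : ℂ) (n : ℕ) :
    diagInt (siegelIntegrand s) (n + 1 / 2) - diagInt (siegelIntegrand s) (n + 1 / 2 + 1) =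
      ((n + 1 : ℕ) : ℂ) ^ (-s) := by
  have hn : (0 : ℝ) ≤ n := n.cast_nonneg
  set a : ℂ := ((n + 1 : ℕ) : ℂ) ^ (-s) with ha
  have c1 := cos_pi_mul_add_half n
  have c2 : Real.cos (Real.pi * (n + 1 / 2 + 1)) = 0 := by
    have := cos_pi_mul_add_half (n + 1); push_cast at this; rwa [add_right_comm]
  have hne : ∀ {d y : ℝ}, (1 ≤ |y| ∨ Real.cos (Real.pi * d) = 0) →
      (d : ℂ) + (1 + Complex.I) * y ≠ (n + 1 : ℕ) := fun {d y} h h0 => by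
    have := one_le_norm_siegelDenom h
    rw [h0, siegelDenom_natCast, norm_zero] at this
    linarith
  have hreg : ∀ d : ℝ, 1 / 2 ≤ d → Real.cos (Real.pi * d) = 0 →
      diagInt (siegelRegular s (n + 1)) d =
        diagInt (siegelIntegrand s) d - a * diagInt (siegelIntegrand 0) d := fun d hd h => by
    rw [← diagInt_sub_const_mul a (integrable_siegelIntegrand_diag hd h s)
      (integrable_siegelIntegrand_diag hd h 0)]
    unfold diagInt
    congr 3
    funext y
    exact siegelRegular_of_ne (hne (Or.inr h))
  obtain ⟨C, hC⟩ := exists_siegelIntegrand_gaussian_bound s.re |s.im| (n + 1 / 2) (by linarith)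
  obtain ⟨C', hC'⟩ := exists_siegelIntegrand_gaussian_bound 0 0 (n + 1 / 2) (by linarith)
  have hshift : diagInt (siegelRegular s (n + 1)) (n + 1 / 2) =
      diagInt (siegelRegular s (n + 1)) (n + 1 / 2 + 1) := by
    refine diagInt_shift (C := C + ‖a‖ * C') (fun z h1 h2 =>
      differentiableAt_siegelRegular (by omega) (by push_cast; linarith)
        (by push_cast; linarith)) fun d y h1 h2 hy => ?_
    rw [siegelRegular_of_ne (hne (Or.inl hy))]
    have b1 := hC s.im d y le_rfl h1 h2 (Or.inl hy)
    have b2 := hC' 0 d y (by simp) h1 h2 (Or.inl hy)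
    rw [Complex.re_add_im] at b1
    simp only [Complex.ofReal_zero, zero_mul, add_zero] at b2
    refine (norm_sub_le _ _).trans ?_
    rw [norm_mul]
    have := mul_le_mul_of_nonneg_left b2 (norm_nonneg a)
    rw [← ha]
    linarith
  rw [hreg _ (by linarith) c1, hreg _ (by linarith) c2] at hshift
  linear_combination hshift + a * diagInt_siegelIntegrand_zero_sub n

lemma riemannAux_eq_sum_add (s : ℂ) (N : ℕ) :
    riemannAux s = ∑ n ∈ Finset.Icc 1 N, (n : ℂ) ^ (-s) +
      diagInt (siegelIntegrand s) (N + 1 / 2) := by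
  induction N with
  | zero => simpa using riemannAux_eq_diagInt s
  | succ k ih =>
    rw [ih, Finset.sum_Icc_succ_top (by omega), ← diagInt_siegelIntegrand_sub s k]
    push_cast
    rw [add_right_comm (k : ℝ) 1 (1 / 2)]
    ring

/-! ### Saddle-point bound for the remaining integral -/

/-- The derivative of the argument is 1/(1 + 2w + 2w²), so right side minus left side has derivative
w(3 + 4w + 2w²)/(1 + 2w + 2w²). This has the sign of w, and the difference is minimal, namely 0, at
w = 0. -/
lemma arg_one_add_diag_le (w : ℝ) :
    Complex.arg (1 + (1 + Complex.I) * w) ≤ w + w ^ 2 / 2 := by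
  set h : ℝ → ℝ := fun w => w + w ^ 2 / 2 - (Complex.log (1 + (1 + Complex.I) * w)).im with hh
  have hD : ∀ w : ℝ, 0 < 1 + 2 * w + 2 * w ^ 2 := fun w => by nlinarith [sq_nonneg (1 + 2 * w)]
  have hder : ∀ w : ℝ, HasDerivAt h (w * (3 + 4 * w + 2 * w ^ 2) / (1 + 2 * w + 2 * w ^ 2)) w := by
    intro w
    have hmem : (1 + (1 + Complex.I) * w : ℂ) ∈ Complex.slitPlane := by
      apply mem_slitPlane_of_diag
      have := diag_re_sub_im 1 w
      push_cast at this
      rw [this]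
      exact one_pos
    have h1 : HasDerivAt (fun w : ℝ => (1 + (1 + Complex.I) * w : ℂ)) (1 + Complex.I) w := by
      simpa using ((HasDerivAt.ofReal_comp (hasDerivAt_id w)).const_mul
        (1 + Complex.I)).const_add (1 : ℂ)
    have h2 := h1.clog_real hmem
    have h3 : HasDerivAt (fun w : ℝ => (Complex.log (1 + (1 + Complex.I) * w)).im)
        ((1 + Complex.I) / (1 + (1 + Complex.I) * w)).im w :=
      Complex.imCLM.hasFDerivAt.comp_hasDerivAt w h2
    have h4 : ((1 + Complex.I) / (1 + (1 + Complex.I) * w)).im = 1 / (1 + 2 * w + 2 * w ^ 2) := by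
      rw [Complex.div_im, Complex.normSq_apply]
      simp
      have := (hD w).ne'
      have h5 : (1 + w) * (1 + w) + w * w ≠ 0 := by
        rwa [show (1 + w) * (1 + w) + w * w = 1 + 2 * w + 2 * w ^ 2 by ring]
      field_simp
      ring
    have h6 : HasDerivAt (fun w : ℝ => w + w ^ 2 / 2) (1 + w) w := by
      exact ((hasDerivAt_id w).add (((hasDerivAt_id w).pow 2).div_const 2)).congr_deriv (by simp)
    have h7 := h6.sub h3
    rw [h4] at h7
    refine h7.congr_deriv ?_
    have := (hD w).ne'
    rw [eq_div_iff this, sub_mul, div_mul_cancel₀ _ this]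
    ring
  have hc : Continuous h := continuous_iff_continuousAt.2 fun w => (hder w).continuousAt
  have hq : ∀ w : ℝ, 0 < 3 + 4 * w + 2 * w ^ 2 := fun w => by nlinarith [sq_nonneg (w + 1)]
  have h0 : h 0 = 0 := by simp [hh]
  have key : 0 ≤ h w := by
    rw [← h0]
    rcases le_total 0 w with hw | hw
    · refine monotoneOn_of_deriv_nonneg (convex_Ici 0) hc.continuousOn
        (fun x _ => (hder x).differentiableAt.differentiableWithinAt) (fun x hx => ?_)
        self_mem_Ici hw hw
      rw [interior_Ici] at hx
      rw [(hder x).deriv]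
      exact div_nonneg (mul_nonneg (le_of_lt hx) (hq x).le) (hD x).le
    · refine antitoneOn_of_deriv_nonpos (convex_Iic 0) hc.continuousOn
        (fun x _ => (hder x).differentiableAt.differentiableWithinAt) (fun x hx => ?_)
        hw self_mem_Iic hw
      rw [interior_Iic] at hx
      rw [(hder x).deriv]
      exact div_nonpos_of_nonpos_of_nonneg
        (mul_nonpos_of_nonpos_of_nonneg (le_of_lt hx) (hq x).le) (hD x).le
  rw [hh] at key
  simp only [Complex.log_im] at key
  linarith

lemma arg_diag_le {d : ℝ} (hd : 0 < d) (y : ℝ) :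
    Complex.arg (d + (1 + Complex.I) * y) ≤ y / d + y ^ 2 / (2 * d ^ 2) := by
  have h := arg_one_add_diag_le (y / d)
  have e : (d : ℂ) + (1 + Complex.I) * y = (d : ℝ) * (1 + (1 + Complex.I) * ((y / d : ℝ) : ℂ)) := by
    have : (d : ℂ) ≠ 0 := by exact_mod_cast hd.ne'
    push_cast
    field_simp
  rw [e, Complex.arg_real_mul _ hd]
  refine h.trans (le_of_eq ?_)
  field_simp

/-- The number of terms of the Dirichlet polynomial approximating `riemannAux` at height `t`. -/
noncomputable def cutoff (t : ℝ) : ℕ := ⌊Real.sqrt (t / (2 * Real.pi))⌋₊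

/-- The Dirichlet polynomial approximating `riemannAux`. -/
noncomputable def dirichletSum (σ t : ℝ) : ℂ :=
  ∑ n ∈ Finset.Icc 1 (cutoff t), (n : ℂ) ^ (-((σ : ℂ) + t * Complex.I))

/-- With t = 2πa², the linear part of the exponent in y is at most 2π(a² − c²)y/c, which is O(|y|)
because |a − c| ≤ 1/2. The quadratic part keeps a definite negative coefficient, and completing the
square leaves −y² with a constant independent of t. -/
lemma siegelIntegrand_saddle_bound (σ : ℝ) {a c : ℝ} (hc : 5 / 2 ≤ c)
    (h1 : c - 1 / 2 ≤ a) (h2 : a ≤ c + 1 / 2) (hcos : Real.cos (Real.pi * c) = 0) (y : ℝ) :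
    ‖siegelIntegrand (σ + (2 * Real.pi * a ^ 2 : ℝ) * Complex.I) (c + (1 + Complex.I) * y)‖ ≤
      2 ^ |σ| * c ^ (-σ) * Real.exp ((4 * |σ| + 4 * Real.pi) ^ 2 / 2) * Real.exp (-1 * y ^ 2) := by
  have hc0 : 0 < c := by linarith
  refine (norm_siegelIntegrand_le (by linarith) (Or.inr hcos) σ _).trans ?_
  rw [mul_assoc _ (Real.exp _) (Real.exp _), ← Real.exp_add]
  refine mul_le_mul_of_nonneg_left (Real.exp_le_exp.2 ?_) (by positivity)
  have hpi := Real.pi_gt_three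
  have harg := mul_le_mul_of_nonneg_left (arg_diag_le hc0 y)
    (show 0 ≤ 2 * Real.pi * a ^ 2 by positivity)
  have e : 2 * Real.pi * a ^ 2 * (y / c + y ^ 2 / (2 * c ^ 2)) - 2 * Real.pi * (c + y) * y =
      2 * Real.pi * ((a ^ 2 - c ^ 2) / c * y - (1 - a ^ 2 / (2 * c ^ 2)) * y ^ 2) := by
    field_simp
    ring
  have b1 : (a ^ 2 - c ^ 2) / c * y ≤ 2 * |y| := by
    refine (le_abs_self _).trans ?_
    rw [abs_mul]
    refine mul_le_mul_of_nonneg_right ?_ (abs_nonneg y)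
    rw [abs_div, abs_of_pos hc0, div_le_iff₀ hc0, abs_le]
    constructor <;> nlinarith
  -- The hypothesis c ≥ 5/2 gives a ≤ 6c/5, so a²/(2c²) ≤ 18/25.
  have b2 : 1 / 4 ≤ 1 - a ^ 2 / (2 * c ^ 2) := by
    have : a ^ 2 / (2 * c ^ 2) ≤ 3 / 4 := by
      rw [div_le_iff₀ (by positivity)]
      nlinarith
    linarith
  have b3 : 2 * Real.pi * ((a ^ 2 - c ^ 2) / c * y - (1 - a ^ 2 / (2 * c ^ 2)) * y ^ 2) ≤
      2 * Real.pi * (2 * |y| - 1 / 4 * y ^ 2) := by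
    refine mul_le_mul_of_nonneg_left ?_ (by positivity)
    have := mul_le_mul_of_nonneg_right b2 (sq_nonneg y)
    linarith
  set K := 4 * |σ| + 4 * Real.pi with hK
  have b4 : K * |y| = 4 * |σ| * |y| + 2 * Real.pi * (2 * |y|) := by rw [hK]; ring
  nlinarith [sq_nonneg (|y| - K), sq_abs y, sq_nonneg y]

lemma rpow_neg_le_of_half_le {a c : ℝ} (hc : 0 < c) (h1 : c / 2 ≤ a) (h2 : a ≤ 2 * c) (σ : ℝ) :
    c ^ (-σ) ≤ 2 ^ |σ| * a ^ (-σ) := by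
  have ha : 0 < a := by linarith
  rcases le_total 0 σ with h | h
  · have := Real.rpow_le_rpow_of_nonpos (z := -σ) (by positivity)
      (show a / 2 ≤ c by linarith) (by linarith)
    rw [abs_of_nonneg h]
    refine this.trans (le_of_eq ?_)
    rw [Real.div_rpow ha.le zero_le_two, Real.rpow_neg zero_le_two]
    field_simp
  · have := Real.rpow_le_rpow (z := -σ) hc.le
      (show c ≤ 2 * a by linarith) (by linarith)
    rw [abs_of_nonpos h]
    rwa [Real.mul_rpow zero_le_two ha.le] at this

lemma exists_norm_sub_dirichletSum_sq_le (σ : ℝ) :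
    ∃ C : ℝ, 0 ≤ C ∧ ∀ t : ℝ, 8 * Real.pi ≤ t →
      ‖riemannAux (σ + t * Complex.I) - dirichletSum σ t‖ ^ 2 ≤ C * t ^ (-σ) := by
  set B : ℝ := 2 ^ |σ| * Real.exp ((4 * |σ| + 4 * Real.pi) ^ 2 / 2) *
    ∫ y : ℝ, Real.exp (-1 * y ^ 2) with hB
  have hB0 : 0 ≤ B := by
    have : 0 ≤ ∫ y : ℝ, Real.exp (-1 * y ^ 2) := integral_nonneg fun y => (Real.exp_pos _).le
    positivity
  refine ⟨(‖1 + Complex.I‖ * B * 2 ^ |σ|) ^ 2 * (2 * Real.pi) ^ σ, by positivity,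
    fun t ht => ?_⟩
  have hpi := Real.pi_pos
  have ht0 : 0 < t := by nlinarith
  set a := Real.sqrt (t / (2 * Real.pi)) with ha
  have hasq : a ^ 2 = t / (2 * Real.pi) := Real.sq_sqrt (by positivity)
  have hta : t = 2 * Real.pi * a ^ 2 := by rw [hasq]; field_simp
  -- The threshold 8π is chosen for this: it makes N ≥ 2 and c = N + 1/2 ≥ 5/2.
  have ha2 : 2 ≤ a := by
    rw [ha]
    refine Real.le_sqrt_of_sq_le ?_
    rw [le_div_iff₀ (by positivity)]
    linarith
  have hN : cutoff t = ⌊a⌋₊ := rfl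
  have hN1 : (cutoff t : ℝ) ≤ a := Nat.floor_le (by linarith)
  have hN2 : a < cutoff t + 1 := Nat.lt_floor_add_one a
  have hN3 : (2 : ℝ) ≤ cutoff t := by
    have : 2 ≤ cutoff t := by rw [hN]; exact Nat.le_floor (by exact_mod_cast ha2)
    exact_mod_cast this
  set c : ℝ := cutoff t + 1 / 2 with hc
  have hc52 : 5 / 2 ≤ c := by linarith
  have hcos : Real.cos (Real.pi * c) = 0 := cos_pi_mul_add_half _
  have hE : ‖riemannAux (σ + t * Complex.I) - dirichletSum σ t‖ ≤
      ‖1 + Complex.I‖ * B * c ^ (-σ) := by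
    rw [riemannAux_eq_sum_add _ (cutoff t), dirichletSum, add_sub_cancel_left, ← hc, diagInt,
      norm_neg, norm_mul, mul_assoc]
    refine mul_le_mul_of_nonneg_left ?_ (norm_nonneg _)
    have hb : ∀ y : ℝ, _ := siegelIntegrand_saddle_bound σ hc52 (a := a) (by linarith)
      (by linarith) hcos
    rw [← hta] at hb
    refine (norm_integral_le_of_norm_le ((integrable_exp_neg_mul_sq one_pos).const_mul _)
      (ae_of_all _ hb)).trans (le_of_eq ?_)
    rw [integral_const_mul, hB]
    ring
  have hca := rpow_neg_le_of_half_le (σ := σ) (show 0 < c by linarith)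
    (show c / 2 ≤ a by linarith) (by linarith)
  have hE2 : ‖riemannAux (σ + t * Complex.I) - dirichletSum σ t‖ ≤
      ‖1 + Complex.I‖ * B * 2 ^ |σ| * a ^ (-σ) := by
    refine hE.trans ?_
    rw [mul_assoc _ ((2 : ℝ) ^ |σ|)]
    exact mul_le_mul_of_nonneg_left hca (by positivity)
  refine (pow_le_pow_left₀ (norm_nonneg _) hE2 2).trans (le_of_eq ?_)
  have : (a ^ (-σ)) ^ 2 = (2 * Real.pi) ^ σ * t ^ (-σ) := by
    rw [Real.rpow_pow_comm (by linarith), hasq,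
      Real.div_rpow ht0.le (by positivity), Real.rpow_neg (by positivity : 0 ≤ 2 * Real.pi)]
    field_simp
  rw [mul_pow, this]
  ring

lemma continuous_auxSq (σ : ℝ) : Continuous (auxSq σ) := by
  have hcos : Real.cos (Real.pi * (1 / 2)) = 0 := by simpa using cos_pi_mul_add_half 0
  have : Continuous fun t : ℝ => riemannAux (σ + t * Complex.I) := by
    simp_rw [riemannAux_eq_diagInt]
    unfold diagInt
    refine (continuous_const.mul ?_).neg
    rw [continuous_iff_continuousAt]
    intro t₀
    -- Dominated convergence on the line through 1/2, with a Gaussian majorant valid for all t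
    -- within distance 1 of t₀.
    obtain ⟨C, hC⟩ := exists_siegelIntegrand_gaussian_bound σ (|t₀| + 1) (1 / 2) le_rfl
    refine continuousAt_of_dominated (bound := fun y => C * Real.exp (-1 * y ^ 2)) ?_ ?_
      ((integrable_exp_neg_mul_sq one_pos).const_mul _) ?_
    · exact Eventually.of_forall fun t =>
        (continuous_siegelIntegrand_diag le_rfl hcos _).aestronglyMeasurable
    · filter_upwards [Metric.ball_mem_nhds t₀ one_pos] with t ht
      refine ae_of_all _ fun y => ?_
      have ht' : |t| ≤ |t₀| + 1 := by
        rw [Metric.mem_ball, Real.dist_eq] at ht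
        linarith [abs_sub_abs_le_abs_sub t t₀]
      simpa using hC t (1 / 2) y ht' le_rfl (by linarith) (Or.inr hcos)
    · refine ae_of_all _ fun y => ?_
      have hx : ((1 / 2 : ℝ) : ℂ) + (1 + Complex.I) * y ≠ 0 := fun h0 => by
        have := diag_re_sub_im (1 / 2) y
        rw [h0] at this
        norm_num at this
      have h1 : Continuous fun t : ℝ =>
          (((1 / 2 : ℝ) : ℂ) + (1 + Complex.I) * y) ^ (-((σ : ℂ) + t * Complex.I)) :=
        Continuous.const_cpow (by fun_prop) (Or.inl hx)
      exact ((h1.mul continuous_const).div_const _).continuousAt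
  exact (this.norm).pow 2

/-! ### Mean square of the Dirichlet polynomial -/

/-- `∑ n ≤ k, n ^ (-2σ)`. -/
noncomputable def powerSum (σ : ℝ) (k : ℕ) : ℝ := ∑ n ∈ Finset.Icc 1 k, (n : ℝ) ^ (-(2 * σ))

lemma powerSum_mono (σ : ℝ) : Monotone (powerSum σ) := fun _ _ h =>
  Finset.sum_le_sum_of_subset_of_nonneg (Finset.Icc_subset_Icc_right h)
    fun n _ _ => Real.rpow_nonneg n.cast_nonneg _

lemma le_cutoff_iff {t : ℝ} (ht : 0 ≤ t) (n : ℕ) :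
    n ≤ cutoff t ↔ 2 * Real.pi * (n : ℝ) ^ 2 ≤ t := by
  have hpi := Real.pi_pos
  rw [cutoff, Nat.le_floor_iff (Real.sqrt_nonneg _), Real.le_sqrt n.cast_nonneg (by positivity),
    le_div_iff₀ (by positivity), mul_comm]

lemma cutoff_mono {t T : ℝ} (h : t ≤ T) : cutoff t ≤ cutoff T := by
  have hpi := Real.pi_pos
  exact Nat.floor_mono (Real.sqrt_le_sqrt (by gcongr))

/-- The contribution of the pair `(m, n)` to the square of `dirichletSum`. -/
noncomputable def pairTerm (σ : ℝ) (m n : ℕ) : ℝ → ℝ :=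
  (Ici (2 * Real.pi * ((max m n : ℕ) : ℝ) ^ 2)).indicator fun t =>
    (m : ℝ) ^ (-σ) * (n : ℝ) ^ (-σ) * Real.cos ((Real.log m - Real.log n) * t)

lemma pairTerm_eq {t : ℝ} (ht : 0 ≤ t) (σ : ℝ) (m n : ℕ) : pairTerm σ m n t =
    if m ≤ cutoff t ∧ n ≤ cutoff t then
      (m : ℝ) ^ (-σ) * (n : ℝ) ^ (-σ) * Real.cos ((Real.log m - Real.log n) * t) else 0 := by
  unfold pairTerm
  rw [Set.indicator_apply]
  refine if_congr ?_ rfl rfl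
  rw [mem_Ici, ← le_cutoff_iff ht, max_le_iff]

lemma natCast_cpow_neg {n : ℕ} (hn : 1 ≤ n) (σ t : ℝ) :
    (n : ℂ) ^ (-((σ : ℂ) + t * Complex.I)) =
      (((n : ℝ) ^ (-σ) * Real.cos (t * Real.log n) : ℝ) : ℂ) +
      ((-((n : ℝ) ^ (-σ) * Real.sin (t * Real.log n)) : ℝ) : ℂ) * Complex.I := by
  have hn0 : (0 : ℝ) < n := by exact_mod_cast hn
  have hne : (n : ℂ) ≠ 0 := by exact_mod_cast hn0.ne'
  rw [neg_add, Complex.cpow_add _ _ hne, ← Complex.ofReal_neg, ← Complex.ofReal_natCast,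
    ← Complex.ofReal_cpow hn0.le, Complex.cpow_def_of_ne_zero (by exact_mod_cast hne),
    ← Complex.ofReal_log hn0.le,
    show (Real.log n : ℂ) * -(t * Complex.I) = ((-(t * Real.log n) : ℝ) : ℂ) * Complex.I by
      push_cast; ring, Complex.exp_mul_I, ← Complex.ofReal_cos, ← Complex.ofReal_sin,
    Real.cos_neg, Real.sin_neg]
  push_cast
  ring

lemma norm_dirichletSum_sq (σ t : ℝ) : ‖dirichletSum σ t‖ ^ 2 =
    ∑ m ∈ Finset.Icc 1 (cutoff t), ∑ n ∈ Finset.Icc 1 (cutoff t),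
      (m : ℝ) ^ (-σ) * (n : ℝ) ^ (-σ) * Real.cos ((Real.log m - Real.log n) * t) := by
  have h : dirichletSum σ t =
      ((∑ n ∈ Finset.Icc 1 (cutoff t), (n : ℝ) ^ (-σ) * Real.cos (t * Real.log n) : ℝ) : ℂ) +
      ((∑ n ∈ Finset.Icc 1 (cutoff t), -((n : ℝ) ^ (-σ) * Real.sin (t * Real.log n)) : ℝ) : ℂ) *
        Complex.I := by
    unfold dirichletSum
    rw [Complex.ofReal_sum, Complex.ofReal_sum, Finset.sum_mul, ← Finset.sum_add_distrib]
    exact Finset.sum_congr rfl fun n hn => natCast_cpow_neg (Finset.mem_Icc.1 hn).1 σ t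
  rw [h, Complex.sq_norm, Complex.normSq_add_mul_I, sq, sq, Finset.sum_mul_sum,
    Finset.sum_mul_sum, ← Finset.sum_add_distrib]
  refine Finset.sum_congr rfl fun m _ => ?_
  rw [← Finset.sum_add_distrib]
  refine Finset.sum_congr rfl fun n _ => ?_
  rw [sub_mul, Real.cos_sub, mul_comm t, mul_comm t]
  ring

lemma sum_Icc_cutoff {t T : ℝ} (h : t ≤ T) (f : ℕ → ℝ) :
    ∑ n ∈ Finset.Icc 1 (cutoff t), f n =
      ∑ n ∈ Finset.Icc 1 (cutoff T), if n ≤ cutoff t then f n else 0 := by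
  rw [← Finset.sum_filter]
  refine Finset.sum_congr (Finset.ext fun n => ?_) fun _ _ => rfl
  have := cutoff_mono h
  simp only [Finset.mem_Icc, Finset.mem_filter]
  omega

/-- The length of the polynomial depends on t. The indicators in `pairTerm` carry this dependence,
so the ranges of summation are fixed by T and sum and integral can be exchanged. -/
lemma norm_dirichletSum_sq_eq_sum_pairTerm (σ : ℝ) {t T : ℝ} (ht : 0 ≤ t) (h : t ≤ T) :
    ‖dirichletSum σ t‖ ^ 2 =
      ∑ m ∈ Finset.Icc 1 (cutoff T), ∑ n ∈ Finset.Icc 1 (cutoff T), pairTerm σ m n t := by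
  rw [norm_dirichletSum_sq, sum_Icc_cutoff h]
  refine Finset.sum_congr rfl fun m _ => ?_
  rw [sum_Icc_cutoff h]
  simp_rw [pairTerm_eq ht]
  by_cases hm : m ≤ cutoff t <;> simp [hm]

lemma powerSum_cutoff_eq_sum_pairTerm (σ : ℝ) {t T : ℝ} (ht : 0 ≤ t) (h : t ≤ T) :
    powerSum σ (cutoff t) = ∑ m ∈ Finset.Icc 1 (cutoff T), pairTerm σ m m t := by
  rw [powerSum, sum_Icc_cutoff h]
  refine Finset.sum_congr rfl fun m hm => ?_
  have hm0 : (0 : ℝ) < m := by exact_mod_cast (Finset.mem_Icc.1 hm).1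
  rw [pairTerm_eq ht, ← Real.rpow_add hm0, sub_self, zero_mul, Real.cos_zero, mul_one,
    show -σ + -σ = -(2 * σ) by ring]
  simp only [and_self]

lemma intervalIntegrable_pairTerm (σ : ℝ) (m n : ℕ) (a b : ℝ) :
    IntervalIntegrable (pairTerm σ m n) volume a b := by
  have h : Continuous fun t : ℝ =>
      (m : ℝ) ^ (-σ) * (n : ℝ) ^ (-σ) * Real.cos ((Real.log m - Real.log n) * t) := by fun_prop
  have h1 := h.intervalIntegrable (μ := volume) a b
  exact ⟨h1.1.indicator measurableSet_Ici, h1.2.indicator measurableSet_Ici⟩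

/-- The pair is present exactly for t in [2π max(m, n)², T], and a cosine of frequency λ ≠ 0
integrates to at most 2/|λ| over any interval. -/
lemma abs_integral_pairTerm_le {σ T : ℝ} {m n : ℕ} (hT : 0 ≤ T) (hm : m ∈ Finset.Icc 1 (cutoff T))
    (hn : n ∈ Finset.Icc 1 (cutoff T)) (hmn : m ≠ n) :
    |∫ t in (0 : ℝ)..T, pairTerm σ m n t| ≤
      (m : ℝ) ^ (-σ) * (n : ℝ) ^ (-σ) * (2 / |Real.log m - Real.log n|) := by
  rw [Finset.mem_Icc] at hm hn
  have hm0 : (0 : ℝ) < m := by exact_mod_cast hm.1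
  have hn0 : (0 : ℝ) < n := by exact_mod_cast hn.1
  have hmax : 1 ≤ max m n := hm.1.trans (le_max_left _ _)
  have hpi := Real.pi_pos
  set b : ℝ := 2 * Real.pi * ((max m n : ℕ) : ℝ) ^ 2 with hb
  have hb0 : 0 < b := by
    have : (0 : ℝ) < (max m n : ℕ) := by exact_mod_cast hmax
    positivity
  have hbT : b ≤ T := (le_cutoff_iff hT _).1 (max_le hm.2 hn.2)
  have hset : Ioc 0 T ∩ Ici b = Icc b T := by
    ext x
    simp only [mem_inter_iff, mem_Ioc, mem_Ici, mem_Icc]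
    constructor
    · rintro ⟨⟨_, h⟩, h'⟩; exact ⟨h', h⟩
    · rintro ⟨h', h⟩; exact ⟨⟨by linarith, h⟩, h'⟩
  have hlam : Real.log m - Real.log n ≠ 0 := by
    intro h
    have := Real.log_injOn_pos hm0 hn0 (sub_eq_zero.1 h)
    exact hmn (by exact_mod_cast this)
  rw [intervalIntegral.integral_of_le hT, pairTerm, setIntegral_indicator measurableSet_Ici, hset,
    integral_Icc_eq_integral_Ioc, ← intervalIntegral.integral_of_le hbT,
    intervalIntegral.integral_const_mul, abs_mul, abs_of_nonneg (by positivity)]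
  refine mul_le_mul_of_nonneg_left ?_ (by positivity)
  rw [intervalIntegral.integral_comp_mul_left _ hlam, integral_cos, smul_eq_mul, abs_mul, abs_inv,
    inv_mul_eq_div]
  refine div_le_div_of_nonneg_right ?_ (abs_nonneg _)
  refine (abs_sub _ _).trans ?_
  linarith [Real.abs_sin_le_one ((Real.log m - Real.log n) * T),
    Real.abs_sin_le_one ((Real.log m - Real.log n) * b)]

/-- For m < n, log(n/m) ≥ 1 − m/n ≥ (n − m)/N. -/
lemma inv_abs_log_sub_log_le {m n N : ℕ} (hm : m ∈ Finset.Icc 1 N) (hn : n ∈ Finset.Icc 1 N)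
    (hmn : m ≠ n) : 1 / |Real.log m - Real.log n| ≤ N * (1 / |(m : ℝ) - n|) := by
  wlog h : m < n generalizing m n
  · rw [abs_sub_comm, abs_sub_comm (m : ℝ)]
    exact this hn hm hmn.symm (by omega)
  rw [Finset.mem_Icc] at hm hn
  have hm0 : (0 : ℝ) < m := by exact_mod_cast hm.1
  have hn0 : (0 : ℝ) < n := by exact_mod_cast hn.1
  have hmn' : (m : ℝ) < n := by exact_mod_cast h
  have hnN : (n : ℝ) ≤ N := by exact_mod_cast hn.2
  have h1 := Real.one_sub_inv_le_log_of_pos (show (0 : ℝ) < n / m by positivity)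
  rw [Real.log_div hn0.ne' hm0.ne', inv_div] at h1
  have h2 : ((n : ℝ) - m) / N ≤ Real.log n - Real.log m := by
    refine le_trans ?_ h1
    rw [show 1 - (m : ℝ) / n = (n - m) / n by field_simp]
    exact div_le_div_of_nonneg_left (by linarith) hn0 hnN
  have hN0 : (0 : ℝ) < N := by linarith
  have h3 : 0 < ((n : ℝ) - m) / N := div_pos (by linarith) hN0
  rw [abs_sub_comm, abs_sub_comm (m : ℝ), abs_of_pos (show 0 < (n : ℝ) - m by linarith),
    abs_of_pos (by linarith : 0 < Real.log n - Real.log m)]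
  refine (one_div_le_one_div_of_le h3 h2).trans (le_of_eq ?_)
  rw [one_div_div, mul_one_div]

lemma sum_one_div_Icc_le (N : ℕ) : ∑ k ∈ Finset.Icc 1 N, 1 / (k : ℝ) ≤ 1 + Real.log N := by
  have := harmonic_le_one_add_log N
  rw [harmonic_eq_sum_Icc] at this
  push_cast at this
  simpa [one_div] using this

lemma sum_one_div_abs_sub_le {N m : ℕ} (hm : m ∈ Finset.Icc 1 N) :
    ∑ n ∈ (Finset.Icc 1 N).erase m, 1 / |(m : ℝ) - n| ≤ 2 * (1 + Real.log N) := by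
  rw [Finset.mem_Icc] at hm
  have hH := sum_one_div_Icc_le N
  have hsplit : (Finset.Icc 1 N).erase m = Finset.Ico 1 m ∪ Finset.Ioc m N := by
    ext n; simp only [Finset.mem_erase, Finset.mem_Icc, Finset.mem_union, Finset.mem_Ico,
      Finset.mem_Ioc]; omega
  have hdisj : Disjoint (Finset.Ico 1 m) (Finset.Ioc m N) := by
    rw [Finset.disjoint_left]
    intro n; simp only [Finset.mem_Ico, Finset.mem_Ioc]; omega
  rw [hsplit, Finset.sum_union hdisj]
  have h1 : ∑ n ∈ Finset.Ico 1 m, 1 / |(m : ℝ) - n| ≤ ∑ k ∈ Finset.Icc 1 N, 1 / (k : ℝ) := by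
    have e : ∑ n ∈ Finset.Ico 1 m, 1 / |(m : ℝ) - n| =
        ∑ k ∈ (Finset.Ico 1 m).image (fun n => m - n), 1 / (k : ℝ) := by
      rw [Finset.sum_image (by
        intro a ha b hb hab
        simp only [Finset.coe_Ico, mem_Ico] at ha hb
        simp only [] at hab
        omega)]
      refine Finset.sum_congr rfl fun n hn => ?_
      rw [Finset.mem_Ico] at hn
      rw [Nat.cast_sub hn.2.le, abs_of_nonneg]
      have : (n : ℝ) ≤ m := by exact_mod_cast hn.2.le
      linarith
    rw [e]
    refine Finset.sum_le_sum_of_subset_of_nonneg (fun k hk => ?_) fun _ _ _ => by positivity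
    simp only [Finset.mem_image, Finset.mem_Ico, Finset.mem_Icc] at hk ⊢
    omega
  have h2 : ∑ n ∈ Finset.Ioc m N, 1 / |(m : ℝ) - n| ≤ ∑ k ∈ Finset.Icc 1 N, 1 / (k : ℝ) := by
    have e : ∑ n ∈ Finset.Ioc m N, 1 / |(m : ℝ) - n| =
        ∑ k ∈ (Finset.Ioc m N).image (fun n => n - m), 1 / (k : ℝ) := by
      rw [Finset.sum_image (by
        intro a ha b hb hab
        simp only [Finset.coe_Ioc, mem_Ioc] at ha hb
        simp only [] at hab
        omega)]
      refine Finset.sum_congr rfl fun n hn => ?_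
      rw [Finset.mem_Ioc] at hn
      rw [Nat.cast_sub hn.1.le, abs_sub_comm, abs_of_nonneg]
      have : (m : ℝ) ≤ n := by exact_mod_cast hn.1.le
      linarith
    rw [e]
    refine Finset.sum_le_sum_of_subset_of_nonneg (fun k hk => ?_) fun _ _ _ => by positivity
    simp only [Finset.mem_image, Finset.mem_Ioc, Finset.mem_Icc] at hk ⊢
    omega
  linarith

/-- The inequality 2ab ≤ a² + b² separates the factors m^{-σ} and n^{-σ}. By symmetry both halves
are equal, and the inner sum of N/|m − n| is at most twice N times a harmonic sum. -/
lemma sum_offDiag_le (σ : ℝ) (N : ℕ) :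
    ∑ m ∈ Finset.Icc 1 N, ∑ n ∈ (Finset.Icc 1 N).erase m,
      (m : ℝ) ^ (-σ) * (n : ℝ) ^ (-σ) * (2 / |Real.log m - Real.log n|) ≤
      4 * N * (1 + Real.log N) * powerSum σ N := by
  have hterm : ∀ m ∈ Finset.Icc 1 N, ∀ n ∈ (Finset.Icc 1 N).erase m,
      (m : ℝ) ^ (-σ) * (n : ℝ) ^ (-σ) * (2 / |Real.log m - Real.log n|) ≤
      (m : ℝ) ^ (-(2 * σ)) * (N * (1 / |(m : ℝ) - n|)) +
        (n : ℝ) ^ (-(2 * σ)) * (N * (1 / |(n : ℝ) - m|)) := fun m hm n hn => by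
    rw [Finset.mem_erase] at hn
    have h1 := inv_abs_log_sub_log_le hm hn.2 hn.1.symm
    have hm0 : (0 : ℝ) < m := by exact_mod_cast (Finset.mem_Icc.1 hm).1
    have hn0 : (0 : ℝ) < n := by exact_mod_cast (Finset.mem_Icc.1 hn.2).1
    have e : ∀ x : ℝ, 0 < x → x ^ (-(2 * σ)) = (x ^ (-σ)) ^ 2 := fun x hx => by
      rw [← Real.rpow_natCast, ← Real.rpow_mul hx.le]; congr 1; push_cast; ring
    rw [e _ hm0, e _ hn0, abs_sub_comm (n : ℝ) m, ← add_mul]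
    calc (m : ℝ) ^ (-σ) * (n : ℝ) ^ (-σ) * (2 / |Real.log m - Real.log n|)
        = (2 * (m : ℝ) ^ (-σ) * (n : ℝ) ^ (-σ)) * (1 / |Real.log m - Real.log n|) := by ring
      _ ≤ (((m : ℝ) ^ (-σ)) ^ 2 + ((n : ℝ) ^ (-σ)) ^ 2) * (N * (1 / |(m : ℝ) - n|)) :=
        mul_le_mul (two_mul_le_add_sq _ _) h1 (by positivity) (by positivity)
  have hrow : ∑ m ∈ Finset.Icc 1 N, ∑ n ∈ (Finset.Icc 1 N).erase m,
      (m : ℝ) ^ (-(2 * σ)) * (N * (1 / |(m : ℝ) - n|)) ≤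
      2 * N * (1 + Real.log N) * powerSum σ N := by
    rw [powerSum, Finset.mul_sum]
    refine Finset.sum_le_sum fun m hm => ?_
    rw [← Finset.mul_sum, ← Finset.mul_sum]
    have h1 := mul_le_mul_of_nonneg_left (sum_one_div_abs_sub_le hm) (N.cast_nonneg (α := ℝ))
    have h2 := mul_le_mul_of_nonneg_left h1
      (Real.rpow_nonneg (m.cast_nonneg (α := ℝ)) (-(2 * σ)))
    refine h2.trans (le_of_eq ?_)
    ring
  have hcol : ∑ m ∈ Finset.Icc 1 N, ∑ n ∈ (Finset.Icc 1 N).erase m,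
      (n : ℝ) ^ (-(2 * σ)) * (N * (1 / |(n : ℝ) - m|)) =
      ∑ m ∈ Finset.Icc 1 N, ∑ n ∈ (Finset.Icc 1 N).erase m,
      (m : ℝ) ^ (-(2 * σ)) * (N * (1 / |(m : ℝ) - n|)) := by
    refine Finset.sum_comm' fun m n => ?_
    simp only [Finset.mem_erase]
    tauto
  calc _ ≤ ∑ m ∈ Finset.Icc 1 N, ∑ n ∈ (Finset.Icc 1 N).erase m,
        ((m : ℝ) ^ (-(2 * σ)) * (N * (1 / |(m : ℝ) - n|)) +
          (n : ℝ) ^ (-(2 * σ)) * (N * (1 / |(n : ℝ) - m|))) :=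
        Finset.sum_le_sum fun m hm => Finset.sum_le_sum (hterm m hm)
    _ ≤ _ := by
      simp_rw [Finset.sum_add_distrib]
      rw [hcol]
      linarith

lemma intervalIntegrable_fun_sum {s : Finset ℕ} {f : ℕ → ℝ → ℝ} {a b : ℝ}
    (h : ∀ n, IntervalIntegrable (f n) volume a b) :
    IntervalIntegrable (fun t => ∑ n ∈ s, f n t) volume a b := by
  have := IntervalIntegrable.sum s (f := f) fun n _ => h n
  rwa [show ∑ n ∈ s, f n = fun t => ∑ n ∈ s, f n t from funext fun t => Finset.sum_apply t s f]
    at this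

lemma intervalIntegrable_norm_dirichletSum_sq (σ : ℝ) {T : ℝ} (hT : 0 ≤ T) :
    IntervalIntegrable (fun t => ‖dirichletSum σ t‖ ^ 2) volume 0 T := by
  have : IntervalIntegrable (fun t => ∑ m ∈ Finset.Icc 1 (cutoff T),
      ∑ n ∈ Finset.Icc 1 (cutoff T), pairTerm σ m n t) volume 0 T := by
    exact intervalIntegrable_fun_sum fun m => intervalIntegrable_fun_sum fun n =>
      intervalIntegrable_pairTerm σ m n 0 T
  refine this.congr fun t ht => ?_
  rw [uIoc_of_le hT] at ht
  exact (norm_dirichletSum_sq_eq_sum_pairTerm σ ht.1.le ht.2).symm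

lemma intervalIntegrable_powerSum_cutoff (σ a b : ℝ) :
    IntervalIntegrable (fun t => powerSum σ (cutoff t)) volume a b :=
  Monotone.intervalIntegrable fun _ _ h => powerSum_mono σ (cutoff_mono h)

lemma abs_integral_norm_dirichletSum_sq_sub_le (σ : ℝ) {T : ℝ} (hT : 0 ≤ T) :
    |(∫ t in (0 : ℝ)..T, ‖dirichletSum σ t‖ ^ 2) - ∫ t in (0 : ℝ)..T, powerSum σ (cutoff t)| ≤
      4 * cutoff T * (1 + Real.log (cutoff T)) * powerSum σ (cutoff T) := by
  have e1 : ∫ t in (0 : ℝ)..T, ‖dirichletSum σ t‖ ^ 2 = ∑ m ∈ Finset.Icc 1 (cutoff T),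
      ∑ n ∈ Finset.Icc 1 (cutoff T), ∫ t in (0 : ℝ)..T, pairTerm σ m n t := by
    rw [intervalIntegral.integral_congr (g := fun t => ∑ m ∈ Finset.Icc 1 (cutoff T),
      ∑ n ∈ Finset.Icc 1 (cutoff T), pairTerm σ m n t) (fun t ht => by
        rw [uIcc_of_le hT] at ht
        exact norm_dirichletSum_sq_eq_sum_pairTerm σ ht.1 ht.2)]
    rw [intervalIntegral.integral_finsetSum fun m _ =>
      intervalIntegrable_fun_sum fun n => intervalIntegrable_pairTerm σ m n 0 T]
    exact Finset.sum_congr rfl fun m _ => intervalIntegral.integral_finsetSum fun n _ =>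
      intervalIntegrable_pairTerm σ m n 0 T
  have e2 : ∫ t in (0 : ℝ)..T, powerSum σ (cutoff t) = ∑ m ∈ Finset.Icc 1 (cutoff T),
      ∫ t in (0 : ℝ)..T, pairTerm σ m m t := by
    rw [intervalIntegral.integral_congr (g := fun t => ∑ m ∈ Finset.Icc 1 (cutoff T),
      pairTerm σ m m t) (fun t ht => by
        rw [uIcc_of_le hT] at ht
        exact powerSum_cutoff_eq_sum_pairTerm σ ht.1 ht.2)]
    exact intervalIntegral.integral_finsetSum fun m _ => intervalIntegrable_pairTerm σ m m 0 T
  rw [e1, e2, ← Finset.sum_sub_distrib]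
  have e3 : ∀ m ∈ Finset.Icc 1 (cutoff T), (∑ n ∈ Finset.Icc 1 (cutoff T),
      ∫ t in (0 : ℝ)..T, pairTerm σ m n t) - ∫ t in (0 : ℝ)..T, pairTerm σ m m t =
      ∑ n ∈ (Finset.Icc 1 (cutoff T)).erase m, ∫ t in (0 : ℝ)..T, pairTerm σ m n t :=
    fun m hm => by rw [← Finset.add_sum_erase _ _ hm, add_sub_cancel_left]
  rw [Finset.sum_congr rfl e3]
  refine le_trans ?_ (sum_offDiag_le σ (cutoff T))
  refine (Finset.abs_sum_le_sum_abs _ _).trans (Finset.sum_le_sum fun m hm => ?_)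
  refine (Finset.abs_sum_le_sum_abs _ _).trans (Finset.sum_le_sum fun n hn => ?_)
  rw [Finset.mem_erase] at hn
  exact abs_integral_pairTerm_le hT hm hn.2 hn.1.symm

/-! ### From the Dirichlet polynomial to `auxSq` through a density -/

/-- Beyond some T₀ the integrand h is at most a small multiple of k; the integral up to T₀ is a
constant, absorbed because M tends to infinity. -/
lemma isLittleO_integral {h k M : ℝ → ℝ}
    (hh : ∀ a b, 1 ≤ a → 1 ≤ b → IntervalIntegrable h volume a b)
    (hk : ∀ a b, 1 ≤ a → 1 ≤ b → IntervalIntegrable k volume a b)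
    (hk0 : ∀ t, 1 ≤ t → 0 ≤ k t) (ho : h =o[atTop] k) (hM : Tendsto M atTop atTop)
    (hkM : (fun T => ∫ t in (1 : ℝ)..T, k t) =O[atTop] M) :
    (fun T => ∫ t in (1 : ℝ)..T, h t) =o[atTop] M := by
  obtain ⟨K, hK, hKM⟩ := hkM.exists_pos
  rw [isLittleO_iff]
  intro c hc
  have ho' := isLittleO_iff.1 ho (show 0 < c / (2 * K) by positivity)
  obtain ⟨T₀, hT₀⟩ := eventually_atTop.1 (ho'.and (eventually_ge_atTop 1))
  have hT₁ : 1 ≤ T₀ := (hT₀ T₀ le_rfl).2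
  filter_upwards [hKM.bound, eventually_ge_atTop T₀,
    hM.eventually_ge_atTop (2 * |∫ t in (1 : ℝ)..T₀, h t| / c)] with T hT hTT hMT
  have hT1 : 1 ≤ T := hT₁.trans hTT
  rw [← intervalIntegral.integral_add_adjacent_intervals (hh 1 T₀ le_rfl hT₁) (hh T₀ T hT₁ hT1)]
  have h1 : ‖∫ t in T₀..T, h t‖ ≤ ∫ t in T₀..T, c / (2 * K) * k t := by
    refine intervalIntegral.norm_integral_le_of_norm_le hTT (ae_of_all _ fun t ht => ?_)
      ((hk T₀ T hT₁ hT1).const_mul _)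
    have := (hT₀ t ht.1.le).1
    rwa [Real.norm_of_nonneg (hk0 t (hT₁.trans ht.1.le))] at this
  have h2 : ∫ t in T₀..T, k t ≤ ∫ t in (1 : ℝ)..T, k t := by
    rw [← intervalIntegral.integral_add_adjacent_intervals (hk 1 T₀ le_rfl hT₁) (hk T₀ T hT₁ hT1)]
    have := intervalIntegral.integral_nonneg (μ := volume) hT₁ fun t ht => hk0 t ht.1
    linarith
  rw [intervalIntegral.integral_const_mul] at h1
  have h3 : ∫ t in (1 : ℝ)..T, k t ≤ K * ‖M T‖ := (Real.le_norm_self _).trans hT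
  have h4 : c / (2 * K) * ∫ t in T₀..T, k t ≤ c / 2 * ‖M T‖ := by
    calc _ ≤ c / (2 * K) * (K * ‖M T‖) := by gcongr; exact h2.trans h3
      _ = _ := by field_simp
  have h5 : |∫ t in (1 : ℝ)..T₀, h t| ≤ c / 2 * ‖M T‖ := by
    rw [div_le_iff₀ hc] at hMT
    have := Real.le_norm_self (M T)
    nlinarith
  refine (norm_add_le _ _).trans ?_
  rw [Real.norm_eq_abs (∫ t in (1 : ℝ)..T₀, h t)]
  linarith

/-- `g` is a density for the mean square of `dirichletSum`. -/
structure IsMeanDensity (σ : ℝ) (g : ℝ → ℝ) : Prop where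
  continuousOn : ContinuousOn g (Ioi 0)
  monotoneOn : MonotoneOn g (Ici 1)
  pos : 0 < g 1
  equiv : (fun t => powerSum σ (cutoff t)) ~[atTop] g
  error : (fun t : ℝ => t ^ (-σ)) =o[atTop] g

namespace IsMeanDensity

variable {σ : ℝ} {g : ℝ → ℝ}

lemma le_of_one_le (hg : IsMeanDensity σ g) {t : ℝ} (ht : 1 ≤ t) : g 1 ≤ g t :=
  hg.monotoneOn self_mem_Ici ht ht

lemma pos_of_one_le (hg : IsMeanDensity σ g) {t : ℝ} (ht : 1 ≤ t) : 0 < g t :=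
  hg.pos.trans_le (hg.le_of_one_le ht)

lemma intervalIntegrable (hg : IsMeanDensity σ g) (a b : ℝ) (ha : 1 ≤ a) (hb : 1 ≤ b) :
    IntervalIntegrable g volume a b :=
  (hg.continuousOn.mono fun _ hx =>
    lt_of_lt_of_le one_pos ((le_inf ha hb).trans hx.1)).intervalIntegrable

lemma tendsto_mul (hg : IsMeanDensity σ g) : Tendsto (fun T => T * g T) atTop atTop := by
  refine tendsto_atTop_mono' atTop ?_ (tendsto_id.atTop_mul_const hg.pos)
  filter_upwards [eventually_ge_atTop 1] with T hT
  exact mul_le_mul_of_nonneg_left (hg.le_of_one_le hT) (zero_le_one.trans hT)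

lemma integral_isBigO (hg : IsMeanDensity σ g) :
    (fun T => ∫ t in (1 : ℝ)..T, g t) =O[atTop] fun T => T * g T := by
  refine IsBigO.of_bound 1 ?_
  filter_upwards [eventually_ge_atTop 1] with T hT
  have h0 := hg.pos_of_one_le hT
  rw [one_mul, Real.norm_of_nonneg (show 0 ≤ T * g T by positivity), Real.norm_of_nonneg
    (intervalIntegral.integral_nonneg hT fun t ht => (hg.pos_of_one_le ht.1).le)]
  have := intervalIntegral.integral_mono_on hT (hg.intervalIntegrable 1 T le_rfl hT)
    (intervalIntegrable_const (c := g T)) fun t ht => hg.monotoneOn ht.1 hT ht.2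
  rw [intervalIntegral.integral_const, smul_eq_mul] at this
  nlinarith

lemma isLittleO_powerSum (hg : IsMeanDensity σ g) :
    (fun T => ∫ t in (1 : ℝ)..T, (powerSum σ (cutoff t) - g t)) =o[atTop] fun T => T * g T :=
  isLittleO_integral
    (fun a b ha hb => (intervalIntegrable_powerSum_cutoff σ a b).sub (hg.intervalIntegrable a b ha hb))
    hg.intervalIntegrable (fun _ ht => (hg.pos_of_one_le ht).le) hg.equiv hg.tendsto_mul
    hg.integral_isBigO

end IsMeanDensity

lemma tendsto_sqrt_div_two_pi :
    Tendsto (fun t : ℝ => Real.sqrt (t / (2 * Real.pi))) atTop atTop :=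
  Real.tendsto_sqrt_atTop.comp (tendsto_id.atTop_div_const Real.two_pi_pos)

lemma tendsto_cutoff : Tendsto cutoff atTop atTop :=
  tendsto_nat_floor_atTop.comp tendsto_sqrt_div_two_pi

lemma cutoff_sq_le {t : ℝ} (ht : 0 ≤ t) : (cutoff t : ℝ) ^ 2 ≤ t := by
  have h := (le_cutoff_iff ht (cutoff t)).1 le_rfl
  nlinarith [Real.pi_gt_three, sq_nonneg (cutoff t : ℝ)]

/-- With N the cutoff, N log N = o(N²), and N² ≤ T. This saving makes the off-diagonal terms
negligible. -/
lemma isLittleO_cutoff_log :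
    (fun T : ℝ => 4 * (cutoff T : ℝ) * (1 + Real.log (cutoff T))) =o[atTop] fun T : ℝ => T := by
  have h1 : (fun x : ℝ => 1 + Real.log x) =o[atTop] fun x : ℝ => x :=
    ((isLittleO_const_id_atTop (1 : ℝ))).add Real.isLittleO_log_id_atTop
  have h2 : (fun x : ℝ => 4 * x * (1 + Real.log x)) =o[atTop] fun x : ℝ => x * x :=
    ((isBigO_refl (fun x : ℝ => x) atTop).const_mul_left 4).mul_isLittleO h1
  have h3 := h2.comp_tendsto ((tendsto_natCast_atTop_atTop (R := ℝ)).comp tendsto_cutoff)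
  refine h3.trans_isBigO (IsBigO.of_bound 1 ?_)
  filter_upwards [eventually_ge_atTop 0] with T hT
  have := cutoff_sq_le hT
  simp only [Function.comp_apply]
  rw [one_mul, Real.norm_of_nonneg hT, Real.norm_of_nonneg (by positivity)]
  nlinarith

namespace IsMeanDensity

variable {σ : ℝ} {g : ℝ → ℝ}

lemma isLittleO_of_bounded_add {f h : ℝ → ℝ} (hg : IsMeanDensity σ g) (C : ℝ)
    (hh : h =o[atTop] fun T => T * g T) (hf : ∀ᶠ T in atTop, |f T| ≤ C + |h T|) :
    f =o[atTop] fun T => T * g T := by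
  have hC : (fun _ : ℝ => C) =o[atTop] fun T => T * g T :=
    isLittleO_const_left.2 (Or.inr (tendsto_norm_atTop_atTop.comp hg.tendsto_mul))
  refine IsBigO.trans_isLittleO (IsBigO.of_bound 1 ?_) (hC.add hh.norm_left)
  filter_upwards [hf] with T hT
  rw [one_mul]
  exact hT.trans (Real.le_norm_self _)

lemma isLittleO_dirichletSum (hg : IsMeanDensity σ g) :
    (fun T => ∫ t in (1 : ℝ)..T, (‖dirichletSum σ t‖ ^ 2 - powerSum σ (cutoff t))) =o[atTop]
      fun T => T * g T := by
  -- The off-diagonal estimate starts at 0 while the densities are compared from 1 on; the piece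
  -- over [0, 1] is a constant.
  set C := |∫ t in (0 : ℝ)..1, (‖dirichletSum σ t‖ ^ 2 - powerSum σ (cutoff t))|
  refine hg.isLittleO_of_bounded_add C (isLittleO_cutoff_log.mul_isBigO hg.equiv.isBigO) ?_
  filter_upwards [eventually_ge_atTop 1] with T hT
  have hT0 : 0 ≤ T := by linarith
  have h1 := intervalIntegrable_norm_dirichletSum_sq σ hT0
  have h2 := intervalIntegrable_powerSum_cutoff σ 0 T
  have h01 : uIcc 0 1 ⊆ uIcc 0 T := by
    rw [uIcc_of_le zero_le_one, uIcc_of_le hT0]; exact Icc_subset_Icc_right hT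
  have h1T : uIcc 1 T ⊆ uIcc 0 T := by
    rw [uIcc_of_le hT, uIcc_of_le hT0]; exact Icc_subset_Icc_left zero_le_one
  have h3 := abs_integral_norm_dirichletSum_sq_sub_le σ hT0
  rw [← intervalIntegral.integral_sub h1 h2, ← intervalIntegral.integral_add_adjacent_intervals
    ((h1.sub h2).mono_set h01) ((h1.sub h2).mono_set h1T)] at h3
  have h4 := abs_sub_abs_le_abs_sub
    (∫ t in (1 : ℝ)..T, (‖dirichletSum σ t‖ ^ 2 - powerSum σ (cutoff t)))
    (-∫ t in (0 : ℝ)..1, (‖dirichletSum σ t‖ ^ 2 - powerSum σ (cutoff t)))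
  rw [abs_neg, sub_neg_eq_add, add_comm] at h4
  have h5 := h3.trans (le_abs_self _)
  linarith

lemma intervalIntegrable_dirichletSum (σ : ℝ) (a b : ℝ) (ha : 1 ≤ a) (hb : 1 ≤ b) :
    IntervalIntegrable (fun t => ‖dirichletSum σ t‖ ^ 2) volume a b := by
  have h0 : 0 ≤ max a b := by linarith [le_max_left a b]
  refine (intervalIntegrable_norm_dirichletSum_sq σ h0).mono_set ?_
  rw [uIcc_of_le h0]
  exact fun x hx => ⟨by linarith [(le_inf ha hb).trans hx.1], hx.2⟩

/-- A pointwise form of Cauchy–Schwarz with a free parameter. Since η can be arbitrarily small, a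
mean-square error of lower order in z − w does not change the leading term. -/
lemma abs_norm_sq_sub_norm_sq_le (z w : ℂ) {η : ℝ} (hη : 0 < η) :
    |‖z‖ ^ 2 - ‖w‖ ^ 2| ≤ η * ‖w‖ ^ 2 + (1 + 1 / η) * ‖z - w‖ ^ 2 := by
  have h1 : ‖z‖ ≤ ‖w‖ + ‖z - w‖ := by simpa using norm_add_le w (z - w)
  have h2 : ‖w‖ ≤ ‖z‖ + ‖z - w‖ := by
    have := norm_sub_le z (z - w); rwa [sub_sub_cancel] at this
  have h3 : 2 * ‖w‖ * ‖z - w‖ ≤ η * ‖w‖ ^ 2 + 1 / η * ‖z - w‖ ^ 2 := by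
    have h4 : 0 ≤ (η * ‖w‖ - ‖z - w‖) ^ 2 / η := by positivity
    have h5 : (η * ‖w‖ - ‖z - w‖) ^ 2 / η =
      η * ‖w‖ ^ 2 + 1 / η * ‖z - w‖ ^ 2 - 2 * ‖w‖ * ‖z - w‖ := by field_simp; ring
    linarith
  have hz := norm_nonneg z
  have hw := norm_nonneg w
  have hd := norm_nonneg (z - w)
  rw [abs_le]
  constructor
  · rcases le_total ‖w‖ ‖z - w‖ with h | h <;> nlinarith
  · nlinarith

lemma integral_dirichletSum_isBigO (hg : IsMeanDensity σ g) :
    (fun T => ∫ t in (1 : ℝ)..T, ‖dirichletSum σ t‖ ^ 2) =O[atTop] fun T => T * g T := by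
  refine ((hg.isLittleO_dirichletSum.isBigO.add hg.isLittleO_powerSum.isBigO).add
    hg.integral_isBigO).congr' ?_ EventuallyEq.rfl
  filter_upwards [eventually_ge_atTop 1] with T hT
  have i1 := intervalIntegrable_dirichletSum σ 1 T le_rfl hT
  have i2 := intervalIntegrable_powerSum_cutoff σ 1 T
  have i3 := hg.intervalIntegrable 1 T le_rfl hT
  rw [← intervalIntegral.integral_add (i1.sub i2) (i2.sub i3),
    ← intervalIntegral.integral_add ((i1.sub i2).add (i2.sub i3)) i3]
  congr 1
  funext t
  ring

lemma intervalIntegrable_rpow_of_one_le (p a b : ℝ) (ha : 1 ≤ a) (hb : 1 ≤ b) :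
    IntervalIntegrable (fun t : ℝ => t ^ p) volume a b := by
  refine ContinuousOn.intervalIntegrable fun x hx =>
    (Real.continuousAt_rpow_const x p (Or.inl ?_)).continuousWithinAt
  have : 1 ≤ x := (le_inf ha hb).trans hx.1
  linarith

lemma isLittleO_auxSq_sub_dirichletSum (hg : IsMeanDensity σ g) :
    (fun T => ∫ t in (1 : ℝ)..T, (auxSq σ t - ‖dirichletSum σ t‖ ^ 2)) =o[atTop]
      fun T => T * g T := by
  obtain ⟨C, hC0, hC⟩ := exists_norm_sub_dirichletSum_sq_le σ
  obtain ⟨K, hK, hKM⟩ := hg.integral_dirichletSum_isBigO.exists_pos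
  have herr : (fun T => ∫ t in (1 : ℝ)..T, t ^ (-σ)) =o[atTop] fun T => T * g T :=
    isLittleO_integral (intervalIntegrable_rpow_of_one_le (-σ)) hg.intervalIntegrable
      (fun _ ht => (hg.pos_of_one_le ht).le) hg.error hg.tendsto_mul hg.integral_isBigO
  have hpi : (1 : ℝ) ≤ 8 * Real.pi := by linarith [Real.pi_gt_three]
  set B := |∫ t in (1 : ℝ)..(8 * Real.pi), (auxSq σ t - ‖dirichletSum σ t‖ ^ 2)| with hB
  rw [isLittleO_iff]
  intro c hc
  -- K bounds the mean square of the polynomial relative to T g(T), so the η-term costs c/2; the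
  -- other half of c pays for the error term and for the interval [1, 8π].
  set η := c / (2 * K) with hη
  have hη0 : 0 < η := by positivity
  have hrest : (fun T => B + (1 + 1 / η) * C * ∫ t in (1 : ℝ)..T, t ^ (-σ)) =o[atTop]
      fun T => T * g T :=
    (isLittleO_const_left.2 (Or.inr (tendsto_norm_atTop_atTop.comp hg.tendsto_mul))).add
      (herr.const_mul_left _)
  filter_upwards [isLittleO_iff.1 hrest (half_pos hc), hKM.bound, eventually_ge_atTop (8 * Real.pi)]
    with T h1 h2 hT
  have hT1 : 1 ≤ T := hpi.trans hT
  have iS := intervalIntegrable_dirichletSum σ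
  have iR := intervalIntegrable_rpow_of_one_le (-σ)
  have iF : ∀ a b, 1 ≤ a → 1 ≤ b →
      IntervalIntegrable (fun t => auxSq σ t - ‖dirichletSum σ t‖ ^ 2) volume a b :=
    fun a b ha hb => ((continuous_auxSq σ).intervalIntegrable a b).sub (iS a b ha hb)
  rw [← intervalIntegral.integral_add_adjacent_intervals (iF _ _ le_rfl hpi) (iF _ _ hpi hT1)]
  have h3 : ‖∫ t in (8 * Real.pi)..T, (auxSq σ t - ‖dirichletSum σ t‖ ^ 2)‖ ≤
      ∫ t in (8 * Real.pi)..T, (η * ‖dirichletSum σ t‖ ^ 2 + (1 + 1 / η) * C * t ^ (-σ)) := by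
    refine intervalIntegral.norm_integral_le_of_norm_le hT (ae_of_all _ fun t ht => ?_)
      (((iS _ _ hpi hT1).const_mul _).add ((iR _ _ hpi hT1).const_mul _))
    refine (abs_norm_sq_sub_norm_sq_le _ _ hη0).trans ?_
    have := mul_le_mul_of_nonneg_left (hC t ht.1.le) (show 0 ≤ 1 + 1 / η by positivity)
    rw [mul_assoc]
    linarith
  have iG : ∀ a b, 1 ≤ a → 1 ≤ b → IntervalIntegrable (fun t =>
      η * ‖dirichletSum σ t‖ ^ 2 + (1 + 1 / η) * C * t ^ (-σ)) volume a b :=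
    fun a b ha hb => ((iS a b ha hb).const_mul _).add ((iR a b ha hb).const_mul _)
  have h4 : ∫ t in (8 * Real.pi)..T, (η * ‖dirichletSum σ t‖ ^ 2 + (1 + 1 / η) * C * t ^ (-σ)) ≤
      ∫ t in (1 : ℝ)..T, (η * ‖dirichletSum σ t‖ ^ 2 + (1 + 1 / η) * C * t ^ (-σ)) := by
    rw [← intervalIntegral.integral_add_adjacent_intervals (iG _ _ le_rfl hpi) (iG _ _ hpi hT1)]
    have := intervalIntegral.integral_nonneg (μ := volume) hpi fun t ht =>
      show 0 ≤ η * ‖dirichletSum σ t‖ ^ 2 + (1 + 1 / η) * C * t ^ (-σ) by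
        have := Real.rpow_nonneg (show 0 ≤ t by linarith [ht.1]) (-σ)
        positivity
    linarith
  rw [intervalIntegral.integral_add ((iS 1 T le_rfl hT1).const_mul _)
    ((iR 1 T le_rfl hT1).const_mul _), intervalIntegral.integral_const_mul,
    intervalIntegral.integral_const_mul] at h4
  have h5 := (Real.le_norm_self _).trans h1
  have h6 := mul_le_mul_of_nonneg_left ((Real.le_norm_self _).trans h2) hη0.le
  have h7 : η * (K * ‖T * g T‖) = c / 2 * ‖T * g T‖ := by rw [hη]; field_simp
  refine (norm_add_le _ _).trans ?_
  rw [Real.norm_eq_abs (∫ t in (1 : ℝ)..(8 * Real.pi), _), ← hB]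
  linarith

theorem isLittleO_auxSq (hg : IsMeanDensity σ g) :
    (fun T => ∫ t in (1 : ℝ)..T, (auxSq σ t - g t)) =o[atTop] fun T => T * g T := by
  refine ((hg.isLittleO_auxSq_sub_dirichletSum.add hg.isLittleO_dirichletSum).add
    hg.isLittleO_powerSum).congr' ?_ EventuallyEq.rfl
  filter_upwards [eventually_ge_atTop 1] with T hT
  have i0 := (continuous_auxSq σ).intervalIntegrable (μ := volume) 1 T
  have i1 := intervalIntegrable_dirichletSum σ 1 T le_rfl hT
  have i2 := intervalIntegrable_powerSum_cutoff σ 1 T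
  have i3 := hg.intervalIntegrable 1 T le_rfl hT
  rw [← intervalIntegral.integral_add (i0.sub i1) (i1.sub i2),
    ← intervalIntegral.integral_add ((i0.sub i1).add (i1.sub i2)) (i2.sub i3)]
  congr 1
  funext t
  ring

end IsMeanDensity

/-! ### Weighted means by partial summation -/

lemma intervalIntegrable_auxSq_mul_rpow (σ ρ : ℝ) {a T : ℝ} (ha : 0 ≤ a) (h : 0 < a ∨ -1 < ρ)
    (hT : a ≤ T) :
    IntervalIntegrable (fun t : ℝ => auxSq σ t * (t / (2 * Real.pi)) ^ ρ) volume a T := by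
  have h1 : IntervalIntegrable (fun t : ℝ => t ^ ρ) volume a T := by
    rcases h with h | h
    · refine ContinuousOn.intervalIntegrable fun x hx =>
        (Real.continuousAt_rpow_const x ρ (Or.inl ?_)).continuousWithinAt
      rw [uIcc_of_le hT] at hx
      linarith [hx.1]
    · exact intervalIntegral.intervalIntegrable_rpow' h
  have h2 := (h1.continuousOn_mul (continuous_auxSq σ).continuousOn).mul_const
    (((2 * Real.pi) ^ ρ)⁻¹)
  refine h2.congr fun t ht => ?_
  rw [uIoc_of_le hT] at ht
  rw [Real.div_rpow (ha.trans ht.1.le) Real.two_pi_pos.le]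
  ring

namespace IsMeanDensity

variable {σ : ℝ} {g : ℝ → ℝ}

/-- Partial summation: the mean of `auxSq σ` against the weight `t ^ ρ`. -/
theorem isLittleO_auxSq_mul_rpow (hg : IsMeanDensity σ g) {ρ : ℝ}
    (htop : Tendsto (fun T => T ^ ρ * (T * g T)) atTop atTop)
    (hI : (fun T => ∫ t in (1 : ℝ)..T, g t * t ^ ρ) =O[atTop] fun T => T ^ ρ * (T * g T)) :
    (fun T => ∫ t in (1 : ℝ)..T, (auxSq σ t - g t) * t ^ ρ) =o[atTop]
      fun T => T ^ ρ * (T * g T) := by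
  set H : ℝ → ℝ := fun T => ∫ t in (1 : ℝ)..T, (auxSq σ t - g t) with hH
  have hH' : H =o[atTop] fun T => T * g T := hg.isLittleO_auxSq
  have hcont : ContinuousOn (fun t => auxSq σ t - g t) (Ioi 0) :=
    (continuous_auxSq σ).continuousOn.sub hg.continuousOn
  have hsub : ∀ {a b : ℝ}, 1 ≤ a → 1 ≤ b → uIcc a b ⊆ Ioi 0 := fun ha hb x hx =>
    lt_of_lt_of_le one_pos ((le_inf ha hb).trans hx.1)
  have hder : ∀ x : ℝ, 1 ≤ x → HasDerivAt H (auxSq σ x - g x) x := fun x hx =>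
    intervalIntegral.integral_hasDerivAt_right (hcont.mono (hsub le_rfl hx)).intervalIntegrable
      (hcont.stronglyMeasurableAtFilter isOpen_Ioi x (lt_of_lt_of_le one_pos hx))
      (hcont.continuousAt (Ioi_mem_nhds (lt_of_lt_of_le one_pos hx)))
  have hHcont : ∀ {a b : ℝ}, 1 ≤ a → 1 ≤ b → ContinuousOn H (uIcc a b) := fun ha hb x hx =>
    (hder x ((le_inf ha hb).trans hx.1)).continuousAt.continuousWithinAt
  have hpow : ∀ x : ℝ, 1 ≤ x → HasDerivAt (fun t : ℝ => t ^ ρ) (ρ * x ^ (ρ - 1)) x :=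
    fun x hx => Real.hasDerivAt_rpow_const (Or.inl (by linarith))
  have hparts : ∀ T : ℝ, 1 ≤ T → ∫ t in (1 : ℝ)..T, (auxSq σ t - g t) * t ^ ρ =
      T ^ ρ * H T - ρ * ∫ t in (1 : ℝ)..T, H t * t ^ (ρ - 1) := fun T hT => by
    have hx1 : ∀ x ∈ uIcc 1 T, 1 ≤ x := fun x hx => (le_inf le_rfl hT).trans hx.1
    have i1 := (hcont.mono (hsub le_rfl hT)).intervalIntegrable (μ := volume)
    have i2 := (intervalIntegrable_rpow_of_one_le (ρ - 1) 1 T le_rfl hT).const_mul ρ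
    have h := intervalIntegral.integral_deriv_mul_eq_sub (a := 1) (b := T)
      (fun x hx => hder x (hx1 x hx)) (fun x hx => hpow x (hx1 x hx)) i1 i2
    have hc : ContinuousOn (fun t : ℝ => t ^ ρ) (uIcc 1 T) := fun x hx =>
      (hpow x (hx1 x hx)).continuousAt.continuousWithinAt
    rw [intervalIntegral.integral_add (i1.mul_continuousOn hc)
      (i2.continuousOn_mul (hHcont le_rfl hT))] at h
    have h0 : H 1 = 0 := by simp [hH]
    have h3 : ∫ t in (1 : ℝ)..T, H t * (ρ * t ^ (ρ - 1)) =
        ρ * ∫ t in (1 : ℝ)..T, H t * t ^ (ρ - 1) := by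
      rw [← intervalIntegral.integral_const_mul]
      congr 1
      funext t
      ring
    rw [h0, h3] at h
    linarith
  have hA : (fun T => T ^ ρ * H T) =o[atTop] fun T => T ^ ρ * (T * g T) :=
    (isBigO_refl _ _).mul_isLittleO hH'
  have hB : (fun T => ∫ t in (1 : ℝ)..T, H t * t ^ (ρ - 1)) =o[atTop]
      fun T => T ^ ρ * (T * g T) := by
    refine isLittleO_integral (k := fun t => g t * t ^ ρ) (fun a b ha hb => ?_)
      (fun a b ha hb => ?_) (fun t ht => ?_) ?_ htop hI
    · exact (intervalIntegrable_rpow_of_one_le _ a b ha hb).continuousOn_mul (hHcont ha hb)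
    · exact (intervalIntegrable_rpow_of_one_le _ a b ha hb).continuousOn_mul
        (hg.continuousOn.mono (hsub ha hb))
    · have := (hg.pos_of_one_le ht).le
      have : 0 ≤ t ^ ρ := Real.rpow_nonneg (by linarith) _
      positivity
    -- As H(t) = o(t g(t)), the integrand H(t) t^{ρ−1} is o(g(t) t^ρ), whose integral is controlled
    -- by `hI`.
    · refine (hH'.mul_isBigO (isBigO_refl (fun t : ℝ => t ^ (ρ - 1)) atTop)).congr'
        EventuallyEq.rfl ?_
      filter_upwards [eventually_gt_atTop 0] with t ht
      rw [Real.rpow_sub_one ht.ne']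
      field_simp
  refine (hA.sub (hB.const_mul_left ρ)).congr' ?_ EventuallyEq.rfl
  filter_upwards [eventually_ge_atTop 1] with T hT
  exact (hparts T hT).symm

/-- Replacing the lower limit 1 by a adds a constant, negligible since T^ρ · T g(T) tends to
infinity. The factor (2π)^{-ρ} comes from the normalization of the weight. -/
theorem isEquivalent_integral (hg : IsMeanDensity σ g) {ρ c : ℝ} (hc : 0 < c)
    (htop : Tendsto (fun T => T ^ ρ * (T * g T)) atTop atTop)
    (hI : (fun T => ∫ t in (1 : ℝ)..T, g t * t ^ ρ) ~[atTop] fun T => c * (T ^ ρ * (T * g T)))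
    {a : ℝ} (ha : 0 ≤ a) (h : 0 < a ∨ -1 < ρ) :
    (fun T => ∫ t in a..T, auxSq σ t * (t / (2 * Real.pi)) ^ ρ) ~[atTop]
      fun T => c * (T * ((T / (2 * Real.pi)) ^ ρ * g T)) := by
  have hO : (fun T => c * (T ^ ρ * (T * g T))) =O[atTop] fun T => T ^ ρ * (T * g T) :=
    isBigO_const_mul_self _ _ _
  have hO' : (fun T => T ^ ρ * (T * g T)) =O[atTop] fun T => c * (T ^ ρ * (T * g T)) :=
    isBigO_self_const_mul hc.ne' _ _
  have h1 := (hg.isLittleO_auxSq_mul_rpow htop (hI.isBigO.trans hO)).trans_isBigO hO'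
  have h2 := h1.add_isEquivalent hI
  set κ : ℝ := (2 * Real.pi) ^ ρ with hκ
  have hκ0 : 0 < κ := Real.rpow_pos_of_pos Real.two_pi_pos _
  have h3 : (fun _ : ℝ => κ * ∫ t in a..1, auxSq σ t * (t / (2 * Real.pi)) ^ ρ) =o[atTop]
      fun T => c * (T ^ ρ * (T * g T)) :=
    isLittleO_const_left.2 (Or.inr (tendsto_norm_atTop_atTop.comp (htop.const_mul_atTop hc)))
  have h4 := (IsEquivalent.refl (u := fun _ : ℝ => κ⁻¹) (l := atTop)).mul (h3.add_isEquivalent h2)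
  refine (h4.congr_left ?_).congr_right ?_
  · filter_upwards [eventually_ge_atTop (max a 1)] with T hT
    have hT1 : 1 ≤ T := (le_max_right _ _).trans hT
    have hTa : a ≤ T := (le_max_left _ _).trans hT
    have i0 := intervalIntegrable_auxSq_mul_rpow σ ρ zero_le_one (Or.inl one_pos) hT1
    have i1 := intervalIntegrable_auxSq_mul_rpow σ ρ ha h hTa
    have i2 : IntervalIntegrable (fun t : ℝ => auxSq σ t * (t / (2 * Real.pi)) ^ ρ) volume a 1 :=
      i1.trans i0.symm
    have j1 : IntervalIntegrable (fun t => (auxSq σ t - g t) * t ^ ρ) volume 1 T :=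
      (intervalIntegrable_rpow_of_one_le ρ 1 T le_rfl hT1).continuousOn_mul
        ((continuous_auxSq σ).continuousOn.sub (hg.continuousOn.mono fun x hx =>
          lt_of_lt_of_le one_pos ((le_inf le_rfl hT1).trans hx.1)))
    have j2 : IntervalIntegrable (fun t => g t * t ^ ρ) volume 1 T :=
      (intervalIntegrable_rpow_of_one_le ρ 1 T le_rfl hT1).continuousOn_mul
        (hg.continuousOn.mono fun x hx =>
          lt_of_lt_of_le one_pos ((le_inf le_rfl hT1).trans hx.1))
    simp only [Pi.mul_apply, Pi.add_apply]
    rw [← intervalIntegral.integral_add j1 j2, ← intervalIntegral.integral_add_adjacent_intervals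
      i2 i0, mul_add, inv_mul_cancel_left₀ hκ0.ne', ← intervalIntegral.integral_const_mul]
    congr 1
    refine intervalIntegral.integral_congr fun t ht => ?_
    rw [uIcc_of_le hT1] at ht
    rw [Real.div_rpow (zero_le_one.trans ht.1) Real.two_pi_pos.le, ← hκ]
    field_simp
    ring
  · filter_upwards [eventually_ge_atTop 0] with T hT
    simp only [Pi.mul_apply]
    rw [Real.div_rpow hT Real.two_pi_pos.le, ← hκ]
    field_simp

theorem isEquivalent_mean (hg : IsMeanDensity σ g) {ρ c : ℝ} (hc : 0 < c)
    (htop : Tendsto (fun T => T ^ ρ * (T * g T)) atTop atTop)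
    (hI : (fun T => ∫ t in (1 : ℝ)..T, g t * t ^ ρ) ~[atTop] fun T => c * (T ^ ρ * (T * g T)))
    {a : ℝ} (ha : 0 ≤ a) (h : 0 < a ∨ -1 < ρ) :
    (fun T => 1 / T * ∫ t in a..T, auxSq σ t * (t / (2 * Real.pi)) ^ ρ) ~[atTop]
      fun T => c * ((T / (2 * Real.pi)) ^ ρ * g T) := by
  have h4 := (IsEquivalent.refl (u := fun T : ℝ => 1 / T) (l := atTop)).mul
    (hg.isEquivalent_integral hc htop hI ha h)
  refine h4.congr_right ?_
  filter_upwards [eventually_gt_atTop 0] with T hT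
  simp only [Pi.mul_apply]
  field_simp

end IsMeanDensity

/-! ### Integrals of the model densities -/

lemma isLittleO_rpow_rpow_atTop {p r : ℝ} (h : p < r) :
    (fun t : ℝ => t ^ p) =o[atTop] fun t : ℝ => t ^ r := by
  refine (isLittleO_iff_tendsto' ?_).2 ?_
  · filter_upwards [eventually_gt_atTop 0] with t ht h0
    exact absurd h0 (Real.rpow_pos_of_pos ht r).ne'
  · refine (tendsto_rpow_neg_atTop (sub_pos.2 h)).congr' ?_
    filter_upwards [eventually_gt_atTop 0] with t ht
    rw [← Real.rpow_sub ht, neg_sub]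

lemma tendsto_rpow_mul_self_mul_rpow {C β ρ : ℝ} (hC : 0 < C) (hq : 0 < β + ρ + 1) :
    Tendsto (fun T : ℝ => T ^ ρ * (T * (C * T ^ β))) atTop atTop := by
  refine ((tendsto_rpow_atTop hq).const_mul_atTop hC).congr' ?_
  filter_upwards [eventually_gt_atTop 0] with T hT
  rw [Real.rpow_add_one hT.ne', Real.rpow_add hT]
  ring

lemma isEquivalent_integral_rpow {C β ρ : ℝ} (hC : 0 < C) (hq : 0 < β + ρ + 1) :
    (fun T => ∫ t in (1 : ℝ)..T, C * t ^ β * t ^ ρ) ~[atTop]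
      fun T => 1 / (β + ρ + 1) * (T ^ ρ * (T * (C * T ^ β))) := by
  have htop := (tendsto_rpow_mul_self_mul_rpow hC hq).const_mul_atTop
    (show 0 < 1 / (β + ρ + 1) by positivity)
  have h := (IsEquivalent.refl (u := fun T : ℝ => 1 / (β + ρ + 1) * (T ^ ρ * (T * (C * T ^ β))))
    (l := atTop)).add_const_of_norm_tendsto_atTop (c := -(C / (β + ρ + 1)))
    (tendsto_norm_atTop_atTop.comp htop)
  refine h.congr_left ?_
  filter_upwards [eventually_ge_atTop 1] with T hT
  have hT0 : 0 < T := by linarith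
  have e : ∫ t in (1 : ℝ)..T, C * t ^ β * t ^ ρ = ∫ t in (1 : ℝ)..T, C * t ^ (β + ρ) := by
    refine intervalIntegral.integral_congr fun t ht => ?_
    rw [uIcc_of_le hT] at ht
    rw [Real.rpow_add (by linarith [ht.1]), mul_assoc]
  rw [e, intervalIntegral.integral_const_mul, integral_rpow (Or.inl (by linarith)),
    Real.one_rpow, Real.rpow_add_one hT0.ne', Real.rpow_add hT0]
  field_simp
  ring

lemma tendsto_rpow_mul_self_mul_log {ρ : ℝ} (hq : 0 < ρ + 1) :
    Tendsto (fun T : ℝ => T ^ ρ * (T * ((1 + Real.log T) / 2))) atTop atTop := by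
  have h1 : Tendsto (fun T : ℝ => (1 + Real.log T) / 2) atTop atTop :=
    (tendsto_atTop_add_const_left _ 1 Real.tendsto_log_atTop).atTop_div_const two_pos
  refine ((tendsto_rpow_atTop hq).atTop_mul_atTop₀ h1).congr' ?_
  filter_upwards [eventually_gt_atTop 0] with T hT
  rw [Real.rpow_add_one hT.ne']
  ring

lemma isEquivalent_integral_log_mul_rpow {ρ : ℝ} (hq : 0 < ρ + 1) :
    (fun T => ∫ t in (1 : ℝ)..T, (1 + Real.log t) / 2 * t ^ ρ) ~[atTop]
      fun T => 1 / (ρ + 1) * (T ^ ρ * (T * ((1 + Real.log T) / 2))) := by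
  set q := ρ + 1 with hqdef
  have htop := (tendsto_rpow_mul_self_mul_log hq).const_mul_atTop
    (show 0 < 1 / (ρ + 1) by positivity)
  have hF : ∀ T : ℝ, 1 ≤ T → ∫ t in (1 : ℝ)..T, (1 + Real.log t) / 2 * t ^ ρ =
      1 / q * (T ^ ρ * (T * ((1 + Real.log T) / 2))) + (-(1 / (2 * q ^ 2)) * T ^ q +
        (1 / (2 * q ^ 2) - 1 / (2 * q))) := fun T hT => by
    -- The primitive found by integrating (1 + log t)t^ρ/2 by parts, with q = ρ + 1. Its second
    -- term, of order T^q, is smaller than the first by a logarithm.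
    have hder : ∀ x ∈ uIcc 1 T, HasDerivAt (fun t : ℝ => t ^ q * ((1 + Real.log t) / (2 * q) -
        1 / (2 * q ^ 2))) ((1 + Real.log x) / 2 * x ^ ρ) x := fun x hx => by
      have hx0 : 0 < x := lt_of_lt_of_le one_pos ((le_inf le_rfl hT).trans hx.1)
      have h1 := Real.hasDerivAt_rpow_const (x := x) (p := q) (Or.inl hx0.ne')
      have h2 := ((((Real.hasDerivAt_log hx0.ne').const_add 1).div_const (2 * q)).sub_const
        (1 / (2 * q ^ 2)))
      refine (h1.mul h2).congr_deriv ?_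
      rw [show q - 1 = ρ by rw [hqdef]; ring, show x ^ q = x ^ ρ * x by
        rw [hqdef, Real.rpow_add_one hx0.ne']]
      field_simp
      ring
    have hint : IntervalIntegrable (fun t : ℝ => (1 + Real.log t) / 2 * t ^ ρ) volume 1 T := by
      refine ContinuousOn.intervalIntegrable fun x hx => ContinuousAt.continuousWithinAt ?_
      have hx0 : x ≠ 0 := (lt_of_lt_of_le one_pos ((le_inf le_rfl hT).trans hx.1)).ne'
      exact ((continuousAt_const.add (Real.continuousAt_log hx0)).div_const 2).mul
        (Real.continuousAt_rpow_const x ρ (Or.inl hx0))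
    rw [intervalIntegral.integral_eq_sub_of_hasDerivAt hder hint, Real.one_rpow, Real.log_one,
      show T ^ q = T ^ ρ * T by rw [hqdef, Real.rpow_add_one (by linarith)]]
    field_simp
    ring
  have hlog : (fun T : ℝ => T ^ q) =o[atTop]
      fun T => 1 / q * (T ^ ρ * (T * ((1 + Real.log T) / 2))) := by
    have h1 : (fun _ : ℝ => (1 : ℝ)) =o[atTop] fun T : ℝ => 1 + Real.log T :=
      isLittleO_const_left.2 (Or.inr (tendsto_norm_atTop_atTop.comp
        (tendsto_atTop_add_const_left _ 1 Real.tendsto_log_atTop)))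
    have h2 := ((isBigO_refl (fun T : ℝ => T ^ q) atTop).mul_isLittleO h1).const_mul_right
      (show 1 / (2 * q) ≠ 0 by positivity)
    refine h2.congr' (Eventually.of_forall fun T => by simp) ?_
    filter_upwards [eventually_gt_atTop 0] with T hT
    rw [show T ^ q = T ^ ρ * T by rw [hqdef, Real.rpow_add_one hT.ne']]
    field_simp
  have hcst : (fun _ : ℝ => 1 / (2 * q ^ 2) - 1 / (2 * q)) =o[atTop]
      fun T => 1 / q * (T ^ ρ * (T * ((1 + Real.log T) / 2))) :=
    isLittleO_const_left.2 (Or.inr (tendsto_norm_atTop_atTop.comp htop))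
  refine (IsEquivalent.refl.add_isLittleO
    ((hlog.const_mul_left (-(1 / (2 * q ^ 2)))).add hcst)).congr_left ?_
  filter_upwards [eventually_ge_atTop 1] with T hT
  exact (hF T hT).symm

/-! ### The density in the three ranges of `σ` -/

lemma powerSum_eq_sum_range (σ : ℝ) (k : ℕ) :
    powerSum σ k = ∑ i ∈ Finset.range k, ((i : ℝ) + 1) ^ (-(2 * σ)) := by
  induction k with
  | zero => simp [powerSum]
  | succ k ih =>
    rw [Finset.sum_range_succ, ← ih, powerSum, Finset.sum_Icc_succ_top (by omega), powerSum]
    push_cast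
    rfl

/-- The difference quotient of (1 − x)^q at 0, taken at x = 1/(i + 1). -/
lemma tendsto_one_sub_rpow_div (q : ℝ) :
    Tendsto (fun i : ℕ => ((i : ℝ) + 1) * (1 - (1 - 1 / ((i : ℝ) + 1)) ^ q)) atTop (𝓝 q) := by
  have h1 : HasDerivAt (fun x : ℝ => (1 - x) ^ q) (-q) 0 := by
    have := ((hasDerivAt_id (0 : ℝ)).const_sub 1).rpow_const (p := q) (Or.inl (by simp))
    simpa using this
  have h2 := h1.tendsto_slope_zero_right
  have h3 : Tendsto (fun i : ℕ => 1 / ((i : ℝ) + 1)) atTop (𝓝[>] 0) :=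
    tendsto_nhdsWithin_iff.2 ⟨tendsto_one_div_add_atTop_nhds_zero_nat,
      Eventually.of_forall fun i => by simp only [mem_Ioi]; positivity⟩
  have h4 := (h2.comp h3).neg
  rw [neg_neg] at h4
  refine h4.congr fun i => ?_
  simp only [Function.comp_apply, zero_add, sub_zero, Real.one_rpow, smul_eq_mul, one_div, inv_inv]
  ring

/-- With q = 1 − 2σ > 0, the increments (i + 1)^q − i^q telescope to k^q and are asymptotic to q(i +
1)^{q−1}. Equivalence of terms passes to the divergent partial sums, whether the terms n^{-2σ}
increase or decrease. -/
lemma isEquivalent_powerSum {σ : ℝ} (hσ : σ < 1 / 2) :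
    (fun k => powerSum σ k) ~[atTop] fun k : ℕ => 1 / (1 - 2 * σ) * (k : ℝ) ^ (1 - 2 * σ) := by
  set q := 1 - 2 * σ with hq
  have hq0 : 0 < q := by linarith
  set u : ℕ → ℝ := fun i => ((i + 1 : ℕ) : ℝ) ^ q - (i : ℝ) ^ q with hu
  have hsum : ∀ k : ℕ, ∑ i ∈ Finset.range k, u i = (k : ℝ) ^ q := fun k => by
    rw [hu, Finset.sum_range_sub (fun i : ℕ => (i : ℝ) ^ q)]
    simp [Real.zero_rpow hq0.ne']
  have hu0 : 0 ≤ u := fun i => by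
    have : (i : ℝ) ^ q ≤ ((i + 1 : ℕ) : ℝ) ^ q :=
      Real.rpow_le_rpow i.cast_nonneg (by push_cast; linarith) hq0.le
    simpa [hu] using this
  have hui : ∀ i, u i = ((i : ℝ) + 1) ^ (-(2 * σ)) *
      (((i : ℝ) + 1) * (1 - (1 - 1 / ((i : ℝ) + 1)) ^ q)) := fun i => by
    have h0 : (0 : ℝ) < (i : ℝ) + 1 := by positivity
    have h1 : (i : ℝ) = ((i : ℝ) + 1) * (1 - 1 / ((i : ℝ) + 1)) := by field_simp; ring
    have h2 : 0 ≤ 1 - 1 / ((i : ℝ) + 1) := by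
      rw [sub_nonneg, div_le_one h0]
      linarith [i.cast_nonneg (α := ℝ)]
    have h3 : (i : ℝ) ^ q = ((i : ℝ) + 1) ^ q * (1 - 1 / ((i : ℝ) + 1)) ^ q := by
      rw [← Real.mul_rpow h0.le h2, ← h1]
    have h4 : ((i : ℝ) + 1) ^ q = ((i : ℝ) + 1) ^ (-(2 * σ)) * ((i : ℝ) + 1) := by
      rw [← Real.rpow_add_one h0.ne']; congr 1; rw [hq]; ring
    simp only [hu]
    rw [h3]
    push_cast
    rw [h4]
    ring
  have heq : u ~[atTop] fun i : ℕ => q * ((i : ℝ) + 1) ^ (-(2 * σ)) := by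
    have h1 := (isEquivalent_const_iff_tendsto hq0.ne').2 (tendsto_one_sub_rpow_div q)
    refine ((IsEquivalent.refl (u := fun i : ℕ => ((i : ℝ) + 1) ^ (-(2 * σ)))).mul h1).congr_left
      (Eventually.of_forall fun i => (hui i).symm) |>.congr_right
      (Eventually.of_forall fun i => ?_)
    simp [mul_comm]
  have htop : Tendsto (fun k => ∑ i ∈ Finset.range k, u i) atTop atTop := by
    simp_rw [hsum]
    exact (tendsto_rpow_atTop hq0).comp tendsto_natCast_atTop_atTop
  have h5 := heq.symm.isLittleO.sum_range hu0 htop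
  have h6 : (fun k => q * powerSum σ k) ~[atTop] fun k : ℕ => (k : ℝ) ^ q := by
    refine h5.congr (fun k => ?_) (fun k => hsum k)
    simp only [Pi.sub_apply, Finset.sum_sub_distrib, hsum, powerSum_eq_sum_range,
      Finset.mul_sum]
  refine ((IsEquivalent.refl (u := fun _ : ℕ => 1 / q)).mul h6).congr_left
    (Eventually.of_forall fun k => ?_)
  simp only [Pi.mul_apply]
  field_simp

lemma isEquivalent_cutoff :
    (fun t => (cutoff t : ℝ)) ~[atTop] fun t => Real.sqrt (t / (2 * Real.pi)) :=
  (isEquivalent_nat_floor (R := ℝ)).comp_tendsto tendsto_sqrt_div_two_pi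

lemma isMeanDensity_of_lt_half {σ : ℝ} (hσ : σ < 1 / 2) :
    IsMeanDensity σ fun t =>
      1 / (1 - 2 * σ) * ((2 * Real.pi) ^ (1 / 2 - σ))⁻¹ * t ^ (1 / 2 - σ) := by
  have hpi := Real.two_pi_pos
  have hκ : 0 < (2 * Real.pi) ^ (1 / 2 - σ) := Real.rpow_pos_of_pos hpi _
  have hq : 0 < 1 - 2 * σ := by linarith
  have hC : 0 < 1 / (1 - 2 * σ) * ((2 * Real.pi) ^ (1 / 2 - σ))⁻¹ := by positivity
  refine ⟨?_, ?_, ?_, ?_, ?_⟩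
  · exact fun x hx => (continuousAt_const.mul
      (Real.continuousAt_rpow_const x _ (Or.inl (ne_of_gt hx)))).continuousWithinAt
  · intro x hx y _ hxy
    exact mul_le_mul_of_nonneg_left
      (Real.rpow_le_rpow (zero_le_one.trans hx) hxy (by linarith)) hC.le
  · simpa only [Real.one_rpow, mul_one] using hC
  · have h1 := (isEquivalent_powerSum hσ).comp_tendsto tendsto_cutoff
    have h2 := isEquivalent_cutoff.rpow (r := 1 - 2 * σ)
      (fun t => Real.sqrt_nonneg _)
    refine h1.trans (((IsEquivalent.refl (u := fun _ : ℝ => 1 / (1 - 2 * σ))).mul h2).congr_right ?_)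
    filter_upwards [eventually_ge_atTop 0] with t ht
    simp only [Pi.mul_apply, Pi.pow_apply]
    rw [Real.sqrt_eq_rpow, ← Real.rpow_mul (by positivity), Real.div_rpow ht hpi.le,
      show 1 / 2 * (1 - 2 * σ) = 1 / 2 - σ by ring]
    field_simp
  · exact (isLittleO_rpow_rpow_atTop (by linarith)).const_mul_right hC.ne'

/-- Here the power sum is a harmonic number, hence ½ log t + O(1). The constant 1 added to log t
only serves to make the density positive at t = 1. -/
lemma isMeanDensity_half : IsMeanDensity (1 / 2) fun t => (1 + Real.log t) / 2 := by
  have htop : Tendsto (fun t : ℝ => (1 + Real.log t) / 2) atTop atTop :=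
    (tendsto_atTop_add_const_left _ 1 Real.tendsto_log_atTop).atTop_div_const two_pos
  refine ⟨?_, ?_, by simp, ?_, ?_⟩
  · exact fun x hx => ((continuousAt_const.add
      (Real.continuousAt_log (ne_of_gt hx))).div_const 2).continuousWithinAt
  · intro x hx y _ hxy
    have := Real.log_le_log (lt_of_lt_of_le one_pos hx) hxy
    simp only []
    linarith
  · refine IsLittleO.isEquivalent (IsBigO.trans_isLittleO (g := fun _ : ℝ => (1 : ℝ)) ?_
      (isLittleO_const_left.2 (Or.inr (tendsto_norm_atTop_atTop.comp htop))))
    refine IsBigO.of_bound (1 + Real.log (2 * Real.pi)) ?_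
    filter_upwards [eventually_ge_atTop (2 * Real.pi)] with t ht
    have hpi : 1 ≤ 2 * Real.pi := by linarith [Real.pi_gt_three]
    have ht0 : 0 < t := by linarith
    have hN : 1 ≤ cutoff t := (le_cutoff_iff ht0.le 1).2 (by simpa using ht)
    have hN0 : (0 : ℝ) < cutoff t := by exact_mod_cast hN
    have hL := Real.log_nonneg hpi
    have e : powerSum (1 / 2) (cutoff t) = (harmonic (cutoff t) : ℝ) := by
      rw [powerSum, harmonic_eq_sum_Icc]
      push_cast
      refine Finset.sum_congr rfl fun n _ => ?_
      rw [show -(2 * (1 / 2 : ℝ)) = -1 by norm_num, Real.rpow_neg_one]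
    have hlow := log_add_one_le_harmonic (cutoff t)
    have hup := harmonic_le_one_add_log (cutoff t)
    have hs : Real.log (Real.sqrt (t / (2 * Real.pi))) =
        (Real.log t - Real.log (2 * Real.pi)) / 2 := by
      rw [Real.log_sqrt (by positivity), Real.log_div ht0.ne' (by positivity)]
    have hspos : 0 < Real.sqrt (t / (2 * Real.pi)) := Real.sqrt_pos.2 (by positivity)
    have h1 : Real.log (Real.sqrt (t / (2 * Real.pi))) ≤ Real.log ((cutoff t + 1 : ℕ) : ℝ) := by
      refine Real.log_le_log hspos ?_
      push_cast
      exact (Nat.lt_floor_add_one _).le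
    have h2 : Real.log (cutoff t) ≤ Real.log (Real.sqrt (t / (2 * Real.pi))) :=
      Real.log_le_log hN0 (Nat.floor_le hspos.le)
    rw [hs] at h1 h2
    simp only [Pi.sub_apply, norm_one, mul_one]
    rw [e, Real.norm_eq_abs, abs_le]
    constructor <;> linarith
  · have h1 : Tendsto (fun t : ℝ => t ^ (-(1 / 2) : ℝ)) atTop (𝓝 0) :=
      tendsto_rpow_neg_atTop (by norm_num)
    exact (h1.isBigO_one ℝ).trans_isLittleO
      (isLittleO_const_left.2 (Or.inr (tendsto_norm_atTop_atTop.comp htop)))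

lemma hasSum_riemannZeta_re {σ : ℝ} (hσ : 1 / 2 < σ) :
    HasSum (fun n : ℕ => (n : ℝ) ^ (-(2 * σ))) (riemannZeta ((2 * σ : ℝ) : ℂ)).re := by
  have hs : Summable fun n : ℕ => (n : ℝ) ^ (-(2 * σ)) :=
    Real.summable_nat_rpow.2 (by linarith)
  have h1 := zeta_eq_tsum_one_div_nat_cpow (s := ((2 * σ : ℝ) : ℂ)) (by
    rw [Complex.ofReal_re]; linarith)
  have h2 : ∀ n : ℕ, 1 / (n : ℂ) ^ ((2 * σ : ℝ) : ℂ) = (((n : ℝ) ^ (-(2 * σ)) : ℝ) : ℂ) :=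
    fun n => by
      rw [Real.rpow_neg n.cast_nonneg, Complex.ofReal_inv, Complex.ofReal_cpow n.cast_nonneg,
        one_div, Complex.ofReal_natCast]
  simp_rw [h2] at h1
  rw [h1, ← Complex.ofReal_tsum, Complex.ofReal_re]
  exact hs.hasSum

lemma riemannZeta_re_pos {σ : ℝ} (hσ : 1 / 2 < σ) :
    0 < (riemannZeta ((2 * σ : ℝ) : ℂ)).re := by
  have h := le_hasSum (hasSum_riemannZeta_re hσ) 1
    fun n _ => Real.rpow_nonneg n.cast_nonneg _
  simp only [Nat.cast_one, Real.one_rpow] at h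
  linarith

lemma isMeanDensity_of_half_lt {σ : ℝ} (hσ : 1 / 2 < σ) :
    IsMeanDensity σ fun _ => (riemannZeta ((2 * σ : ℝ) : ℂ)).re := by
  have hz := riemannZeta_re_pos hσ
  refine ⟨continuousOn_const, fun _ _ _ _ _ => le_rfl, hz, ?_, ?_⟩
  · refine (isEquivalent_const_iff_tendsto hz.ne').2 ?_
    have h1 := (tendsto_add_atTop_iff_nat 1).2 (hasSum_riemannZeta_re hσ).tendsto_sum_nat
    refine (h1.comp tendsto_cutoff).congr fun t => ?_
    simp only [Function.comp_apply]
    rw [Finset.sum_range_succ', powerSum_eq_sum_range]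
    -- The zeta series also runs over n = 0, where the power with nonzero exponent is 0.
    simp [Real.zero_rpow (show -(2 * σ) ≠ 0 by linarith)]
  · exact (isLittleO_const_iff hz.ne').2 (tendsto_rpow_neg_atTop (by linarith))

/-! ### An Abelian theorem for the Laplace transform -/

lemma integral_rpow_mul_exp_neg_Ioi {p ε : ℝ} (hp : 0 < p) (hε : 0 < ε) :
    ε * ∫ t in Ioi (0 : ℝ), t ^ p * Real.exp (-ε * t) = Real.Gamma (p + 1) * ε ^ (-p) := by
  have h := Real.integral_rpow_mul_exp_neg_mul_Ioi (show 0 < p + 1 by linarith) hε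
  rw [add_sub_cancel_right] at h
  simp_rw [neg_mul]
  rw [h, one_div, Real.inv_rpow hε.le, Real.rpow_add_one hε.ne', Real.rpow_neg hε.le]
  field_simp

lemma integrableOn_rpow_mul_exp_neg {p ε : ℝ} (hp : 0 < p) (hε : 0 < ε) :
    IntegrableOn (fun t : ℝ => t ^ p * Real.exp (-ε * t)) (Ioi 0) := by
  have := integrableOn_rpow_mul_exp_neg_mul_rpow (show -1 < p by linarith) one_pos hε
  simpa only [Real.rpow_one] using this

lemma integral_exp_neg_mul_Ioi_zero {ε : ℝ} (hε : 0 < ε) :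
    ε * ∫ t in Ioi (0 : ℝ), Real.exp (-ε * t) = 1 := by
  rw [integral_exp_mul_Ioi (by linarith)]
  field_simp
  simp

section Laplace

variable {f : ℝ → ℝ}

/-- Turns the asymptotic relation into an inequality on all of [1, ∞): M absorbs the initial range,
where the integral is increasing and thus bounded. -/
lemma laplace_bound {B p : ℝ} (hp : 0 < p) (hf : ContinuousOn f (Ioi 0))
    (hf0 : ∀ t, 1 ≤ t → 0 ≤ f t)
    (hK : (fun T => ∫ t in (1 : ℝ)..T, f t) ~[atTop] fun T => B * T ^ p) {η : ℝ} (hη : 0 < η) :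
    ∃ M, 0 ≤ M ∧ ∀ T, 1 ≤ T → |(∫ t in (1 : ℝ)..T, f t) - B * T ^ p| ≤ η * T ^ p + M := by
  have hi : ∀ a b, 1 ≤ a → 1 ≤ b → IntervalIntegrable f volume a b := fun a b ha hb =>
    (hf.mono fun x hx => lt_of_lt_of_le one_pos ((le_inf ha hb).trans hx.1)).intervalIntegrable
  have ho : (fun T => (∫ t in (1 : ℝ)..T, f t) - B * T ^ p) =o[atTop] fun T : ℝ => T ^ p :=
    hK.isLittleO.trans_isBigO (isBigO_const_mul_self _ _ _)
  obtain ⟨T₀, hT₀⟩ := eventually_atTop.1 ((isLittleO_iff.1 ho hη).and (eventually_ge_atTop 1))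
  have h1 : 1 ≤ T₀ := (hT₀ T₀ le_rfl).2
  have hnn : ∀ T, 1 ≤ T → 0 ≤ ∫ t in (1 : ℝ)..T, f t := fun T hT =>
    intervalIntegral.integral_nonneg hT fun t ht => hf0 t ht.1
  have hpp : ∀ T : ℝ, 1 ≤ T → 0 ≤ T ^ p := fun T hT => Real.rpow_nonneg (by linarith) _
  refine ⟨(∫ t in (1 : ℝ)..T₀, f t) + |B| * T₀ ^ p,
    add_nonneg (hnn _ h1) (mul_nonneg (abs_nonneg _) (hpp _ h1)), fun T hT => ?_⟩
  rcases le_total T₀ T with h | h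
  · have := (hT₀ T h).1
    rw [Real.norm_eq_abs, Real.norm_of_nonneg (hpp T hT)] at this
    linarith [hnn _ h1, mul_nonneg (abs_nonneg B) (hpp _ h1)]
  · have h2 : ∫ t in (1 : ℝ)..T, f t ≤ ∫ t in (1 : ℝ)..T₀, f t := by
      rw [← intervalIntegral.integral_add_adjacent_intervals (hi 1 T le_rfl hT) (hi T T₀ hT h1)]
      have := intervalIntegral.integral_nonneg (μ := volume) h fun t ht => hf0 t (hT.trans ht.1)
      linarith
    have h3 : |B * T ^ p| ≤ |B| * T₀ ^ p := by
      rw [abs_mul, abs_of_nonneg (hpp T hT)]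
      exact mul_le_mul_of_nonneg_left (Real.rpow_le_rpow (by linarith) h hp.le) (abs_nonneg _)
    have h4 := abs_sub (∫ t in (1 : ℝ)..T, f t) (B * T ^ p)
    rw [abs_of_nonneg (hnn T hT)] at h4
    have := mul_nonneg hη.le (hpp T hT)
    linarith

/-- Integration by parts on [1, R]; the boundary term vanishes as R → ∞ because the primitive of f
grows at most like T^p. -/
lemma laplace_by_parts {B p : ℝ} (hp : 0 < p) (hf : ContinuousOn f (Ioi 0))
    (hf0 : ∀ t, 1 ≤ t → 0 ≤ f t)
    (hK : (fun T => ∫ t in (1 : ℝ)..T, f t) ~[atTop] fun T => B * T ^ p) {ε : ℝ} (hε : 0 < ε) :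
    IntegrableOn (fun t => f t * Real.exp (-ε * t)) (Ioi 1) ∧
    IntegrableOn (fun T => (∫ t in (1 : ℝ)..T, f t) * Real.exp (-ε * T)) (Ioi 1) ∧
    ∫ t in Ioi (1 : ℝ), f t * Real.exp (-ε * t) =
      ε * ∫ T in Ioi (1 : ℝ), (∫ t in (1 : ℝ)..T, f t) * Real.exp (-ε * T) := by
  obtain ⟨M, hM0, hM⟩ := laplace_bound hp hf hf0 hK one_pos
  set K : ℝ → ℝ := fun T => ∫ t in (1 : ℝ)..T, f t with hKdef
  set D := |B| + 1 + M with hD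
  have hDK : ∀ T, 1 ≤ T → |K T| ≤ D * T ^ p := fun T hT => by
    have h1 : 1 ≤ T ^ p := Real.one_le_rpow hT hp.le
    have h2 := abs_sub_abs_le_abs_sub (K T) (B * T ^ p)
    rw [abs_mul, abs_of_nonneg (zero_le_one.trans h1)] at h2
    have := hM T hT
    rw [hD]
    nlinarith
  have hsub : ∀ {T : ℝ}, 1 ≤ T → uIcc 1 T ⊆ Ioi 0 := fun hT x hx =>
    lt_of_lt_of_le one_pos ((le_inf le_rfl hT).trans hx.1)
  have hder : ∀ x : ℝ, 1 ≤ x → HasDerivAt K (f x) x := fun x hx =>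
    intervalIntegral.integral_hasDerivAt_right (hf.mono (hsub hx)).intervalIntegrable
      (hf.stronglyMeasurableAtFilter isOpen_Ioi x (lt_of_lt_of_le one_pos hx))
      (hf.continuousAt (Ioi_mem_nhds (lt_of_lt_of_le one_pos hx)))
  have hKc : ContinuousOn K (Ici 1) := fun x hx => (hder x hx).continuousAt.continuousWithinAt
  have hexp : Continuous fun t : ℝ => Real.exp (-ε * t) := by fun_prop
  have iK : IntegrableOn (fun T => K T * Real.exp (-ε * T)) (Ioi 1) := by
    refine (((integrableOn_rpow_mul_exp_neg hp hε).mono_set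
      (Ioi_subset_Ioi zero_le_one)).const_mul D).mono' ?_ ?_
    · exact ((hKc.mono Ioi_subset_Ici_self).mul hexp.continuousOn).aestronglyMeasurable
        measurableSet_Ioi
    · refine (ae_restrict_iff' measurableSet_Ioi).2 (ae_of_all _ fun t ht => ?_)
      rw [norm_mul, Real.norm_eq_abs, Real.norm_of_nonneg (Real.exp_pos _).le, ← mul_assoc]
      exact mul_le_mul_of_nonneg_right (hDK t (le_of_lt ht)) (Real.exp_pos _).le
  have hparts : ∀ R : ℝ, 1 ≤ R → ∫ t in (1 : ℝ)..R, f t * Real.exp (-ε * t) =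
      K R * Real.exp (-ε * R) + ε * ∫ t in (1 : ℝ)..R, K t * Real.exp (-ε * t) := fun R hR => by
    have hx1 : ∀ x ∈ uIcc 1 R, 1 ≤ x := fun x hx => (le_inf le_rfl hR).trans hx.1
    have hKc' : ContinuousOn K (uIcc 1 R) := hKc.mono hx1
    have i1 := (hf.mono (hsub hR)).intervalIntegrable (μ := volume)
    have i2 : IntervalIntegrable (fun t : ℝ => Real.exp (-ε * t) * -ε) volume 1 R :=
      (by fun_prop : Continuous fun t : ℝ => Real.exp (-ε * t) * -ε).intervalIntegrable _ _
    have h := intervalIntegral.integral_deriv_mul_eq_sub (a := 1) (b := R)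
      (fun x hx => hder x (hx1 x hx)) (v := fun t => Real.exp (-ε * t)) (fun x _ => by
        simpa using ((hasDerivAt_id x).const_mul (-ε)).exp) i1 i2
    rw [intervalIntegral.integral_add (i1.mul_continuousOn hexp.continuousOn)
      (i2.continuousOn_mul hKc')] at h
    have h0 : K 1 = 0 := by simp [hKdef]
    have h3 : ∫ t in (1 : ℝ)..R, K t * (Real.exp (-ε * t) * -ε) =
        -ε * ∫ t in (1 : ℝ)..R, K t * Real.exp (-ε * t) := by
      rw [← intervalIntegral.integral_const_mul]
      congr 1
      funext t
      ring
    rw [h0, h3] at h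
    linarith
  have hlim0 : Tendsto (fun R => K R * Real.exp (-ε * R)) atTop (𝓝 0) := by
    have h1 := (tendsto_rpow_mul_exp_neg_mul_atTop_nhds_zero p ε hε).const_mul D
    rw [mul_zero] at h1
    refine squeeze_zero_norm' ?_ h1
    filter_upwards [eventually_ge_atTop 1] with R hR
    rw [norm_mul, Real.norm_eq_abs, Real.norm_of_nonneg (Real.exp_pos _).le, ← mul_assoc]
    exact mul_le_mul_of_nonneg_right (hDK R hR) (Real.exp_pos _).le
  have hlim : Tendsto (fun R => ∫ t in (1 : ℝ)..R, f t * Real.exp (-ε * t)) atTop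
      (𝓝 (ε * ∫ T in Ioi (1 : ℝ), K T * Real.exp (-ε * T))) := by
    have h1 := hlim0.add ((intervalIntegral_tendsto_integral_Ioi 1 iK tendsto_id).const_mul ε)
    rw [zero_add] at h1
    refine h1.congr' ?_
    filter_upwards [eventually_ge_atTop 1] with R hR
    exact (hparts R hR).symm
  -- Since f ≥ 0 on [1, ∞), convergence of the integrals over [1, R] already gives absolute
  -- integrability.
  have hint : IntegrableOn (fun t => f t * Real.exp (-ε * t)) (Ioi 1) := by
    have hii : ∀ R : ℝ, IntegrableOn (fun t => f t * Real.exp (-ε * t)) (Ioc 1 R) := fun R => by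
      refine IntegrableOn.mono_set (t := Icc 1 R) ?_ Ioc_subset_Icc_self
      exact ((hf.mono fun x hx => lt_of_lt_of_le one_pos hx.1).mul
        hexp.continuousOn).integrableOn_Icc
    refine integrableOn_Ioi_of_intervalIntegral_norm_tendsto _ 1 hii tendsto_id
      (hlim.congr' ?_)
    filter_upwards [eventually_ge_atTop 1] with R hR
    refine intervalIntegral.integral_congr fun t ht => ?_
    rw [uIcc_of_le hR] at ht
    exact (Real.norm_of_nonneg (mul_nonneg (hf0 t ht.1) (Real.exp_pos _).le)).symm
  exact ⟨hint, iK, tendsto_nhds_unique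
    (intervalIntegral_tendsto_integral_Ioi 1 hint tendsto_id) hlim⟩

/-- An Abelian theorem for the Laplace transform. -/
theorem laplace_isEquivalent {B p : ℝ} (hB : 0 < B) (hp : 0 < p) (hf : ContinuousOn f (Ioi 0))
    (hf0 : ∀ t, 1 ≤ t → 0 ≤ f t)
    (hK : (fun T => ∫ t in (1 : ℝ)..T, f t) ~[atTop] fun T => B * T ^ p) :
    (fun ε => ∫ t in Ioi (1 : ℝ), f t * Real.exp (-ε * t)) ~[𝓝[>] (0 : ℝ)]
      fun ε => B * (Real.Gamma (p + 1) * ε ^ (-p)) := by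
  have hΓ : 0 < Real.Gamma (p + 1) := Real.Gamma_pos_of_pos (by linarith)
  refine IsLittleO.isEquivalent (isLittleO_iff.2 fun c hc => ?_)
  -- Half of the allowed error c·B·Γ(p + 1)ε^{-p} goes to ηT^p. The other half covers the bounded
  -- term M + B, once ε is so small that ε^{-p} exceeds the threshold below.
  set η := c * B / 2 with hη
  have hη0 : 0 < η := by positivity
  obtain ⟨M, hM0, hM⟩ := laplace_bound hp hf hf0 hK hη0
  set K : ℝ → ℝ := fun T => ∫ t in (1 : ℝ)..T, f t with hKdef
  have htop : Tendsto (fun ε : ℝ => ε ^ (-p)) (𝓝[>] 0) atTop :=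
    tendsto_rpow_neg_nhdsGT_zero (by linarith)
  filter_upwards [self_mem_nhdsWithin, htop.eventually_ge_atTop
    ((M + B) / (c * B / 2 * Real.Gamma (p + 1)))] with ε hε hbig
  have hε0 : 0 < ε := hε
  obtain ⟨-, iK, hJ⟩ := laplace_by_parts hp hf hf0 hK hε0
  have iP := integrableOn_rpow_mul_exp_neg hp hε0
  have iE : IntegrableOn (fun t : ℝ => Real.exp (-ε * t)) (Ioi 0) := by
    simpa using integrableOn_exp_mul_Ioi (a := -ε) (by linarith) 0
  have hset : Ioi (0 : ℝ) ∩ Ioi 1 = Ioi 1 := inter_eq_right.2 (Ioi_subset_Ioi zero_le_one)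
  have hind : ∫ T in Ioi (1 : ℝ), K T * Real.exp (-ε * T) =
      ∫ T in Ioi (0 : ℝ), (Ioi (1 : ℝ)).indicator (fun T => K T * Real.exp (-ε * T)) T := by
    rw [setIntegral_indicator measurableSet_Ioi, hset]
  have iK' : IntegrableOn ((Ioi (1 : ℝ)).indicator fun T => K T * Real.exp (-ε * T)) (Ioi 0) :=
    ((integrable_indicator_iff measurableSet_Ioi).2 iK).integrableOn
  have hdiff : (∫ t in Ioi (1 : ℝ), f t * Real.exp (-ε * t)) -
      B * (Real.Gamma (p + 1) * ε ^ (-p)) = ε * ∫ T in Ioi (0 : ℝ),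
        ((Ioi (1 : ℝ)).indicator (fun T => K T * Real.exp (-ε * T)) T -
          B * (T ^ p * Real.exp (-ε * T))) := by
    rw [integral_sub iK' (iP.const_mul B), integral_const_mul, mul_sub, ← hind, ← hJ,
      ← integral_rpow_mul_exp_neg_Ioi hp hε0]
    ring
  have hle : ‖∫ T in Ioi (0 : ℝ), ((Ioi (1 : ℝ)).indicator (fun T => K T * Real.exp (-ε * T)) T -
        B * (T ^ p * Real.exp (-ε * T)))‖ ≤
      ∫ T in Ioi (0 : ℝ), (η * (T ^ p * Real.exp (-ε * T)) + (M + B) * Real.exp (-ε * T)) := by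
    refine norm_integral_le_of_norm_le ((iP.const_mul η).add (iE.const_mul (M + B)))
      ((ae_restrict_iff' measurableSet_Ioi).2 (ae_of_all _ fun T hT => ?_))
    have hT0 : (0 : ℝ) < T := hT
    have he := Real.exp_pos (-ε * T)
    have hTp : 0 ≤ T ^ p := Real.rpow_nonneg hT0.le _
    by_cases h1 : T ∈ Ioi (1 : ℝ)
    · rw [indicator_of_mem h1, ← mul_assoc, ← sub_mul, norm_mul, Real.norm_eq_abs,
        Real.norm_of_nonneg he.le, ← mul_assoc, ← add_mul]
      refine mul_le_mul_of_nonneg_right ?_ he.le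
      linarith [hM T (le_of_lt h1)]
    -- On (0, 1] only B T^p ≤ B remains, which accounts for the B in M + B.
    · rw [indicator_of_notMem h1, zero_sub, norm_neg, Real.norm_of_nonneg (by positivity)]
      have hT1 : T ^ p ≤ 1 := Real.rpow_le_one hT0.le (not_lt.1 h1) hp.le
      have h2 : B * (T ^ p * Real.exp (-ε * T)) ≤ B * Real.exp (-ε * T) := by
        refine mul_le_mul_of_nonneg_left ?_ hB.le
        nlinarith
      have h3 : 0 ≤ η * (T ^ p * Real.exp (-ε * T)) := by positivity
      have h4 : 0 ≤ M * Real.exp (-ε * T) := by positivity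
      linarith
  rw [integral_add (iP.const_mul η) (iE.const_mul (M + B)), integral_const_mul,
    integral_const_mul] at hle
  have hle2 := mul_le_mul_of_nonneg_left hle hε0.le
  have e1 := integral_rpow_mul_exp_neg_Ioi hp hε0
  have e2 := integral_exp_neg_mul_Ioi_zero hε0
  have hεp : 0 < ε ^ (-p) := Real.rpow_pos_of_pos hε0 _
  rw [div_le_iff₀ (by positivity)] at hbig
  simp only [Pi.sub_apply]
  rw [hdiff, norm_mul, Real.norm_of_nonneg hε0.le, Real.norm_of_nonneg
    (show 0 ≤ B * (Real.Gamma (p + 1) * ε ^ (-p)) by positivity)]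
  refine hle2.trans ?_
  calc _ = η * (ε * ∫ T in Ioi (0 : ℝ), T ^ p * Real.exp (-ε * T)) +
        (M + B) * (ε * ∫ T in Ioi (0 : ℝ), Real.exp (-ε * T)) := by ring
    _ = η * (Real.Gamma (p + 1) * ε ^ (-p)) + (M + B) := by rw [e1, e2, mul_one]
    _ ≤ _ := by rw [hη]; linarith

end Laplace

/-! ### The explicit main terms -/

lemma density_of_lt_half_eq (σ : ℝ) {t : ℝ} (ht : 0 ≤ t) :
    1 / (1 - 2 * σ) * ((2 * Real.pi) ^ (1 / 2 - σ))⁻¹ * t ^ (1 / 2 - σ) =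
      1 / (1 - 2 * σ) * (t / (2 * Real.pi)) ^ (1 / 2 - σ) := by
  rw [Real.div_rpow ht Real.two_pi_pos.le]
  ring

lemma isEquivalent_one_add_log :
    (fun T : ℝ => (1 + Real.log T) / 2) ~[atTop]
      fun T => 1 / 2 * Real.log (T / (2 * Real.pi)) := by
  have htop : Tendsto (fun T : ℝ => 1 / 2 * Real.log (T / (2 * Real.pi))) atTop atTop :=
    (Real.tendsto_log_atTop.comp (tendsto_id.atTop_div_const Real.two_pi_pos)).const_mul_atTop
      (by norm_num)
  refine ((IsEquivalent.refl (u := fun T : ℝ => 1 / 2 * Real.log (T / (2 * Real.pi)))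
    (l := atTop)).add_const_of_norm_tendsto_atTop (c := (1 + Real.log (2 * Real.pi)) / 2)
    (tendsto_norm_atTop_atTop.comp htop)).congr_left ?_
  filter_upwards [eventually_gt_atTop 0] with T hT
  rw [Real.log_div hT.ne' Real.two_pi_pos.ne']
  ring

/-- Used with ρ = 0 and ρ = σ. In the second case 1/2 − σ + ρ + 1 = 3/2 for every σ, so only
integrability at the lower limit restricts σ. -/
lemma mean_of_lt_half {σ : ℝ} (hσ : σ < 1 / 2) {ρ a : ℝ} (hq : 0 < 1 / 2 - σ + ρ + 1) (ha : 0 ≤ a)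
    (h : 0 < a ∨ -1 < ρ) :
    (fun T => 1 / T * ∫ t in a..T, auxSq σ t * (t / (2 * Real.pi)) ^ ρ) ~[atTop]
      fun T => 1 / ((1 / 2 - σ + ρ + 1) * (1 - 2 * σ)) *
        (T / (2 * Real.pi)) ^ (ρ + (1 / 2 - σ)) := by
  have hpi := Real.two_pi_pos
  have hκ : 0 < (2 * Real.pi) ^ (1 / 2 - σ) := Real.rpow_pos_of_pos hpi _
  have h1 : 0 < 1 - 2 * σ := by linarith
  have hC : 0 < 1 / (1 - 2 * σ) * ((2 * Real.pi) ^ (1 / 2 - σ))⁻¹ := by positivity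
  refine ((isMeanDensity_of_lt_half hσ).isEquivalent_mean (by positivity)
    (tendsto_rpow_mul_self_mul_rpow hC hq) (isEquivalent_integral_rpow hC hq) ha h).congr_right ?_
  filter_upwards [eventually_gt_atTop 0] with T hT
  rw [density_of_lt_half_eq σ hT.le, Real.rpow_add (by positivity)]
  field_simp

lemma mean_half {ρ a : ℝ} (hq : 0 < ρ + 1) (ha : 0 ≤ a) (h : 0 < a ∨ -1 < ρ) :
    (fun T => 1 / T * ∫ t in a..T, auxSq (1 / 2) t * (t / (2 * Real.pi)) ^ ρ) ~[atTop]
      fun T => 1 / (ρ + 1) * ((T / (2 * Real.pi)) ^ ρ * (1 / 2 * Real.log (T / (2 * Real.pi)))) :=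
  (isMeanDensity_half.isEquivalent_mean (by positivity) (tendsto_rpow_mul_self_mul_log hq)
    (isEquivalent_integral_log_mul_rpow hq) ha h).trans
    (IsEquivalent.refl.mul (IsEquivalent.refl.mul isEquivalent_one_add_log))

lemma mean_of_half_lt {σ : ℝ} (hσ : 1 / 2 < σ) {ρ a : ℝ} (hq : 0 < ρ + 1) (ha : 0 ≤ a)
    (h : 0 < a ∨ -1 < ρ) :
    (fun T => 1 / T * ∫ t in a..T, auxSq σ t * (t / (2 * Real.pi)) ^ ρ) ~[atTop]
      fun T => 1 / (ρ + 1) * ((T / (2 * Real.pi)) ^ ρ * (riemannZeta ((2 * σ : ℝ) : ℂ)).re) := by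
  have hz := riemannZeta_re_pos hσ
  have hq' : 0 < 0 + ρ + 1 := by linarith
  have h1 := tendsto_rpow_mul_self_mul_rpow hz hq'
  have h2 := isEquivalent_integral_rpow hz hq'
  simp only [Real.rpow_zero, mul_one, zero_add] at h1 h2
  exact (isMeanDensity_of_half_lt hσ).isEquivalent_mean (by positivity) h1 h2 ha h

lemma auxSq_nonneg (σ t : ℝ) : 0 ≤ auxSq σ t := by
  unfold auxSq
  positivity

/-- Γ(5/2) = ¾√π, so the numerical factor is (2/3)(3/4)2^{-1/2} = 2^{-3/2}, and the powers of π
cancel. -/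
lemma laplace_constant {σ ε : ℝ} (hε : 0 < ε) :
    2 / (3 * (1 - 2 * σ)) * (2 * Real.pi) ^ (-(1 / 2) : ℝ) *
      (Real.Gamma (3 / 2 + 1) * ε ^ (-(3 / 2) : ℝ)) = (2 * ε) ^ (-(3 / 2) : ℝ) / (1 - 2 * σ) := by
  have hpi := Real.pi_pos
  have hΓ : Real.Gamma (3 / 2 + 1) = 3 / 4 * Real.pi ^ (1 / 2 : ℝ) := by
    rw [Real.Gamma_add_one (by norm_num), show (3 / 2 : ℝ) = 1 / 2 + 1 by norm_num,
      Real.Gamma_add_one (by norm_num), Real.Gamma_one_half_eq, Real.sqrt_eq_rpow]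
    ring
  have h2 : (2 : ℝ) ^ (-(3 / 2) : ℝ) = 2 ^ (-(1 / 2) : ℝ) / 2 := by
    rw [← Real.rpow_sub_one two_ne_zero]
    norm_num
  rw [hΓ, Real.mul_rpow two_pos.le hpi.le, Real.mul_rpow two_pos.le hε.le, h2,
    Real.rpow_neg hpi.le]
  have : Real.pi ^ (1 / 2 : ℝ) ≠ 0 := (Real.rpow_pos_of_pos hpi _).ne'
  field_simp
  ring

lemma laplace_of_lt_half {σ : ℝ} (hσ : σ < 1 / 2) :
    (∀ ε : ℝ, 0 < ε →
      IntegrableOn (fun t : ℝ => auxSq σ t * (t / (2 * Real.pi)) ^ σ * Real.exp (-ε * t))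
        (Ioi 1)) ∧
    (fun ε : ℝ =>
      ∫ t in Ioi (1 : ℝ), auxSq σ t * (t / (2 * Real.pi)) ^ σ * Real.exp (-ε * t))
      ~[𝓝[>] (0 : ℝ)] (fun ε : ℝ => (2 * ε) ^ (-(3 / 2) : ℝ) / (1 - 2 * σ)) := by
  have hpi := Real.two_pi_pos
  have h1 : 0 < 1 - 2 * σ := by linarith
  have hB : 0 < 2 / (3 * (1 - 2 * σ)) * (2 * Real.pi) ^ (-(1 / 2) : ℝ) := by positivity
  have hmean := mean_of_lt_half hσ (ρ := σ) (by linarith) zero_le_one (Or.inl one_pos)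
  have hK : (fun T => ∫ t in (1 : ℝ)..T, auxSq σ t * (t / (2 * Real.pi)) ^ σ) ~[atTop]
      fun T => 2 / (3 * (1 - 2 * σ)) * (2 * Real.pi) ^ (-(1 / 2) : ℝ) * T ^ (3 / 2 : ℝ) := by
    -- Multiplying the mean by T recovers the integral, of order T · T^{1/2}; this is the source of
    -- the exponent 3/2.
    refine ((IsEquivalent.refl (u := fun T : ℝ => T)).mul hmean).congr_left ?_ |>.congr_right ?_
    · filter_upwards [eventually_gt_atTop 0] with T hT
      simp only [Pi.mul_apply]
      field_simp
    · filter_upwards [eventually_gt_atTop 0] with T hT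
      simp only [Pi.mul_apply]
      rw [show (3 / 2 : ℝ) = 1 / 2 + 1 by norm_num, Real.rpow_add_one hT.ne',
        show σ + (1 / 2 - σ) = 1 / 2 by ring, Real.div_rpow hT.le hpi.le, Real.rpow_neg hpi.le,
        show 1 / 2 - σ + σ + 1 = 3 / 2 by ring]
      field_simp
  have hf : ContinuousOn (fun t : ℝ => auxSq σ t * (t / (2 * Real.pi)) ^ σ) (Ioi 0) :=
    fun x hx => ((continuous_auxSq σ).continuousAt.mul
      ((continuousAt_id.div_const _).rpow_const
        (Or.inl (div_pos hx hpi).ne'))).continuousWithinAt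
  have hf0 : ∀ t : ℝ, 1 ≤ t → 0 ≤ auxSq σ t * (t / (2 * Real.pi)) ^ σ := fun t ht =>
    mul_nonneg (auxSq_nonneg σ t) (Real.rpow_nonneg (by positivity) _)
  refine ⟨fun ε hε => (laplace_by_parts (by norm_num) hf hf0 hK hε).1, ?_⟩
  refine (laplace_isEquivalent hB (by norm_num) hf hf0 hK).congr_right ?_
  filter_upwards [self_mem_nhdsWithin] with ε hε
  exact laplace_constant hε

theorem mainTheorem11 :
    -- the Laplace-type mean value, for every `σ < 1/2`
    (∀ σ : ℝ, σ < 1 / 2 →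
      (∀ ε : ℝ, 0 < ε →
        IntegrableOn (fun t : ℝ => auxSq σ t * (t / (2 * Real.pi)) ^ σ * Real.exp (-ε * t))
          (Ioi 1)) ∧
      (fun ε : ℝ =>
        ∫ t in Ioi (1 : ℝ), auxSq σ t * (t / (2 * Real.pi)) ^ σ * Real.exp (-ε * t))
        ~[𝓝[>] (0 : ℝ)] (fun ε : ℝ => (2 * ε) ^ (-(3 / 2) : ℝ) / (1 - 2 * σ))) ∧
    -- the main terms of the unweighted mean
    ((∀ σ T : ℝ, 0 ≤ T → IntervalIntegrable (fun t : ℝ => auxSq σ t) volume 0 T) ∧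
      (∀ σ : ℝ, σ < 1 / 2 →
        (fun T : ℝ => 1 / T * ∫ t in (0 : ℝ)..T, auxSq σ t)
          ~[atTop] (fun T : ℝ => 2 / ((1 - 2 * σ) * (3 - 2 * σ)) *
            (T / (2 * Real.pi)) ^ (1 / 2 - σ))) ∧
      ((fun T : ℝ => 1 / T * ∫ t in (0 : ℝ)..T, auxSq (1 / 2) t)
          ~[atTop] (fun T : ℝ => 1 / 2 * Real.log (T / (2 * Real.pi)))) ∧
      (∀ σ : ℝ, 1 / 2 < σ →
        (fun T : ℝ => 1 / T * ∫ t in (0 : ℝ)..T, auxSq σ t)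
          ~[atTop] (fun _ : ℝ => (riemannZeta ((2 * σ : ℝ) : ℂ)).re))) ∧
    -- the main terms of the mean weighted by `(t / 2π)^σ`; the lower limit `a` may be `0`
    -- as soon as `t^σ` is integrable there
    (∀ σ a : ℝ, 0 ≤ a → (0 < a ∨ -1 < σ) →
      (∀ T : ℝ, a ≤ T →
        IntervalIntegrable (fun t : ℝ => auxSq σ t * (t / (2 * Real.pi)) ^ σ) volume a T) ∧
      (σ < 1 / 2 →
        (fun T : ℝ => 1 / T * ∫ t in a..T, auxSq σ t * (t / (2 * Real.pi)) ^ σ)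
          ~[atTop] (fun T : ℝ => 2 / (3 * (1 - 2 * σ)) *
            (T / (2 * Real.pi)) ^ (1 / 2 : ℝ))) ∧
      (σ = 1 / 2 →
        (fun T : ℝ => 1 / T * ∫ t in a..T, auxSq σ t * (t / (2 * Real.pi)) ^ σ)
          ~[atTop] (fun T : ℝ => 1 / 3 * (T / (2 * Real.pi)) ^ (1 / 2 : ℝ) *
            Real.log (T / (2 * Real.pi)))) ∧
      (1 / 2 < σ →
        (fun T : ℝ => 1 / T * ∫ t in a..T, auxSq σ t * (t / (2 * Real.pi)) ^ σ)
          ~[atTop] (fun T : ℝ => (riemannZeta ((2 * σ : ℝ) : ℂ)).re / (1 + σ) *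
            (T / (2 * Real.pi)) ^ σ))) := by
  refine ⟨fun σ hσ => laplace_of_lt_half hσ, ⟨fun σ T _ => (continuous_auxSq σ).intervalIntegrable
    0 T, fun σ hσ => ?_, ?_, fun σ hσ => ?_⟩, fun σ a ha h =>
    ⟨fun T hT => intervalIntegrable_auxSq_mul_rpow σ σ ha h hT, fun hσ => ?_, fun hσ => ?_,
      fun hσ => ?_⟩⟩
  · have h := mean_of_lt_half hσ (ρ := 0) (by linarith) le_rfl (Or.inr (by norm_num))
    simp only [Real.rpow_zero, mul_one, zero_add, add_zero] at h
    refine h.congr_right (Eventually.of_forall fun T => ?_)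
    have h1 : 1 - 2 * σ ≠ 0 := by linarith
    have h2 : 3 - 2 * σ ≠ 0 := by linarith
    simp only []
    rw [show 1 / 2 - σ + 1 = (3 - 2 * σ) / 2 by ring]
    field_simp
  · simpa using mean_half (ρ := 0) (by norm_num) le_rfl (Or.inr (by norm_num))
  · simpa using mean_of_half_lt hσ (ρ := 0) (by norm_num) le_rfl (Or.inr (by norm_num))
  · refine (mean_of_lt_half hσ (ρ := σ) (by linarith) ha h).congr_right
      (Eventually.of_forall fun T => ?_)
    have h1 : 1 - 2 * σ ≠ 0 := by linarith
    simp only []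
    rw [show σ + (1 / 2 - σ) = 1 / 2 by ring, show 1 / 2 - σ + σ + 1 = 3 / 2 by ring]
    field_simp
  · subst hσ
    refine (mean_half (ρ := 1 / 2) (by norm_num) ha h).congr_right
      (Eventually.of_forall fun T => ?_)
    simp only []
    ring
  · refine (mean_of_half_lt hσ (ρ := σ) (by linarith) ha h).congr_right
      (Eventually.of_forall fun T => ?_)
    simp only []
    ring
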